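/- Let $N\ge 3$, let $\Omega\subset\mathbb{R}^N$ be a bounded open set, and let $p,\gamma>0$. Let $a:\Omega\to\mathbb{R}$ be measurable with $0<\alpha\le a(x)\le\beta$ for almost every $x\in\Omega$, where $\alpha,\beta$ are positive constants, and let $f\in L^m(\Omega)$ for some $m\in[1,\infty]$, with $f\ge 0$ almost everywhere in $\Omega$. For $k>0$ let $T_k(s)=\max\{-k,\min\{s,k\}\}$ denote truncation at levels $\pm k$. Then for every integer $n\ge 1$ the problem $$ \begin{cases} -\operatorname{div}\left(\dfrac{a(x)\nabla u_n}{(1+|T_n(u_n)|)^p}\right)=\dfrac{T_n(f)}{\left(|u_n|+\frac1n\right)^\gamma} & \text{in }\Omega,\\[2mm] u_n=0 & \text{on }\partial\Omega, \end{cases} $$ has a weak solution $u_n\in H^1_0(\Omega)\cap L^\infty(\Omega)$ with $u_n\ge 0$ almost everywhere in $\Omega$; that is, such a $u_n$ exists with $$ \int_\Omega \frac{a(x)\,\nabla u_n\cdot\nabla v}{(1+|T_n(u_n)|)^p}\,dx=\int_\Omega \frac{T_n(f)}{\left(|u_n|+\frac1n\right)^\gamma}\,v\,dx\qquad\text{for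 every } v\in H^1_0(\Omega), $$ both integrals being absolutely convergent. Here $H^1_0(\Omega)$ is the closure of $C_c^\infty(\Omega)$ in $H^1(\Omega)$. -/

import Mathlib

open MeasureTheory Filter Topology
open scoped ENNReal ContDiff RealInnerProductSpace

namespace DegenerateElliptic

/-- Truncation at levels `-k` and `k` (for `0 ≤ k`). -/
noncomputable def trunc (k s : ℝ) : ℝ := max (-k) (min s k)

theorem trunc_of_le_neg {k s : ℝ} (hk : 0 ≤ k) (h : s ≤ -k) : trunc k s = -k := by
  unfold trunc
  rw [min_eq_left (by linarith), max_eq_left h]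

theorem trunc_of_mem {k s : ℝ} (h₁ : -k ≤ s) (h₂ : s ≤ k) : trunc k s = s := by
  unfold trunc
  rw [min_eq_left h₂, max_eq_right h₁]

theorem trunc_of_ge {k s : ℝ} (hk : 0 ≤ k) (h : k ≤ s) : trunc k s = k := by
  unfold trunc
  rw [min_eq_right h, max_eq_right (by linarith)]

/-- `φ ∈ C_c^∞(Ω)`, extended by zero to the whole space. -/
structure IsTestFunction {N : ℕ} (Ω : Set (EuclideanSpace ℝ (Fin N)))
    (φ : EuclideanSpace ℝ (Fin N) → ℝ) : Prop where
  contDiff : ContDiff ℝ ∞ φ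
  hasCompactSupport : HasCompactSupport φ
  tsupport_subset : tsupport φ ⊆ Ω

/-- `g` is a weak (distributional) gradient of `u` on the open set `Ω`. Only the values of `u` and
`g` on `Ω` matter, up to null sets. The equation is an identity of vectors in `ℝ^N`, that is, one
integration by parts for each partial derivative. -/
structure HasWeakGradient {N : ℕ} (Ω : Set (EuclideanSpace ℝ (Fin N)))
    (u : EuclideanSpace ℝ (Fin N) → ℝ)
    (g : EuclideanSpace ℝ (Fin N) → EuclideanSpace ℝ (Fin N)) : Prop where
  locallyIntegrableOn : LocallyIntegrableOn u Ω volume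
  locallyIntegrableOn_grad : LocallyIntegrableOn g Ω volume
  integral_eq : ∀ φ : EuclideanSpace ℝ (Fin N) → ℝ, IsTestFunction Ω φ →
    ∫ x in Ω, u x • gradient φ x = - ∫ x in Ω, φ x • g x

/-- `u ∈ H¹(Ω)`, with weak gradient `g`. -/
structure IsH1 {N : ℕ} (Ω : Set (EuclideanSpace ℝ (Fin N)))
    (u : EuclideanSpace ℝ (Fin N) → ℝ)
    (g : EuclideanSpace ℝ (Fin N) → EuclideanSpace ℝ (Fin N)) : Prop where
  memLp : MemLp u 2 (volume.restrict Ω)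
  memLp_grad : MemLp g 2 (volume.restrict Ω)
  hasWeakGradient : HasWeakGradient Ω u g

/-- `u ∈ H¹₀(Ω)`, with weak gradient `g`: `u` belongs to the closure of `C_c^∞(Ω)` in the norm of
`H¹(Ω)`. -/
structure IsH10 {N : ℕ} (Ω : Set (EuclideanSpace ℝ (Fin N)))
    (u : EuclideanSpace ℝ (Fin N) → ℝ)
    (g : EuclideanSpace ℝ (Fin N) → EuclideanSpace ℝ (Fin N)) : Prop where
  isH1 : IsH1 Ω u g
  exists_approx : ∃ φ : ℕ → EuclideanSpace ℝ (Fin N) → ℝ,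
    (∀ k, IsTestFunction Ω (φ k)) ∧
    Tendsto (fun k => eLpNorm (fun x => φ k x - u x) 2 (volume.restrict Ω)) atTop (𝓝 0) ∧
    Tendsto (fun k => eLpNorm (fun x => gradient (φ k) x - g x) 2 (volume.restrict Ω))
      atTop (𝓝 0)

/-- `u ∈ H¹₀(Ω)`. -/
def MemH10 {N : ℕ} (Ω : Set (EuclideanSpace ℝ (Fin N)))
    (u : EuclideanSpace ℝ (Fin N) → ℝ) : Prop :=
  ∃ g, IsH10 Ω u g

/-- `u ∈ H¹₀(Ω)` is a weak solution of `-div (A ∇u) = F` in `Ω`, `u = 0` on `∂Ω`, tested against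
every element of `H¹₀(Ω)`; the convergence of both integrals is part of the definition. (The weak
gradient `g` of `u` is unique almost everywhere in `Ω`.) -/
def IsWeakDirichletSolution {N : ℕ} (Ω : Set (EuclideanSpace ℝ (Fin N)))
    (A F u : EuclideanSpace ℝ (Fin N) → ℝ) : Prop :=
  ∃ g, IsH10 Ω u g ∧ ∀ v h, IsH10 Ω v h →
    IntegrableOn (fun x => A x * ⟪g x, h x⟫) Ω volume ∧
    IntegrableOn (fun x => F x * v x) Ω volume ∧
    ∫ x in Ω, A x * ⟪g x, h x⟫ = ∫ x in Ω, F x * v x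

/-- `u` is a weak solution of
`-div (a(x) ∇u / (1 + |T_n(u)|)^p) = T_n(f) / (|u| + 1/n)^γ` in `Ω`, `u = 0` on `∂Ω`. -/
def IsApproxSolution {N : ℕ} (Ω : Set (EuclideanSpace ℝ (Fin N)))
    (a f : EuclideanSpace ℝ (Fin N) → ℝ) (p γ : ℝ) (n : ℕ)
    (u : EuclideanSpace ℝ (Fin N) → ℝ) : Prop :=
  IsWeakDirichletSolution Ω
    (fun x => a x / (1 + |trunc n (u x)|) ^ p)
    (fun x => trunc n (f x) / (|u x| + 1 / (n : ℝ)) ^ γ)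
    u

end DegenerateElliptic

namespace DegenerateElliptic

variable {N : ℕ} {Ω : Set (EuclideanSpace ℝ (Fin N))}

/-! ### Calculus of test functions. -/

section TestFunction

variable {φ ψ : EuclideanSpace ℝ (Fin N) → ℝ}

/-! For fixed `n` the degeneracy is only apparent: `D s = (1 + |T_n s|) ^ p` is continuous with
values in `[1, (1 + n) ^ p]`. Kirchhoff's transformation `w = ∫₀ᵘ ds / D s` gives `∇u = D(u) ∇w`, so
with the inverse map `u = Ψ(w)` the equation becomes `-div (a ∇w) = T_n(f) θ(w)`, where `θ(s) = (max
(Ψ s) 0 + 1/n) ^ (-γ)`. The principal part is now linear and uniformly elliptic.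

Since `Ψ` is increasing, `θ` is nonincreasing, and it is Lipschitz and bounded. Hence the operator
is strongly monotone and Lipschitz on `H¹₀`, and a contraction argument solves the problem
(`exists_semilinear_solution`); no compactness or Schauder fixed point is needed.

The right-hand side is nonnegative and bounded, so `w ≥ 0` by testing with the negative part
(`ae_nonneg_of_weak_solution`), and `w` is bounded by Stampacchia's level-set method
(`exists_ae_le_of_weak_solution`). Both properties pass to `u = Ψ(w)`, and `u ≥ 0` turns `max u 0`
back into `|u|`. The supporting theory is the chain rule and truncation in `H¹₀` (`IsH10.comp`,
`IsH10.max_sub`), Sobolev's inequality (`exists_sobolev_const`) and the inverse transformation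
(`exists_kirchhoff`). -/

theorem IsTestFunction.hasGradientAt (h : IsTestFunction Ω φ) (x : EuclideanSpace ℝ (Fin N)) :
    HasGradientAt φ (gradient φ x) x :=
  (h.contDiff.differentiable (by simp) x).hasGradientAt

theorem IsTestFunction.continuous_gradient (h : IsTestFunction Ω φ) :
    Continuous (gradient φ) :=
  (InnerProductSpace.toDual ℝ _).symm.continuous.comp (h.contDiff.continuous_fderiv (by simp))

theorem IsTestFunction.hasCompactSupport_gradient (h : IsTestFunction Ω φ) :
    HasCompactSupport (gradient φ) :=
  (h.hasCompactSupport.fderiv (𝕜 := ℝ)).comp_left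
    (g := (InnerProductSpace.toDual ℝ (EuclideanSpace ℝ (Fin N))).symm) (map_zero _)

theorem IsTestFunction.memLp (h : IsTestFunction Ω φ) (p : ℝ≥0∞) :
    MemLp φ p (volume.restrict Ω) :=
  (h.contDiff.continuous.memLp_of_hasCompactSupport h.hasCompactSupport).restrict _

theorem IsTestFunction.memLp_gradient (h : IsTestFunction Ω φ) (p : ℝ≥0∞) :
    MemLp (gradient φ) p (volume.restrict Ω) :=
  (h.continuous_gradient.memLp_of_hasCompactSupport h.hasCompactSupport_gradient).restrict _

theorem IsTestFunction.eq_zero_of_notMem (h : IsTestFunction Ω φ)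
    {x : EuclideanSpace ℝ (Fin N)} (hx : x ∉ Ω) : φ x = 0 :=
  image_eq_zero_of_notMem_tsupport fun hx' => hx (h.tsupport_subset hx')

theorem IsTestFunction.add (h : IsTestFunction Ω φ) (h' : IsTestFunction Ω ψ) :
    IsTestFunction Ω (fun x => φ x + ψ x) where
  contDiff := h.contDiff.add h'.contDiff
  hasCompactSupport := h.hasCompactSupport.add h'.hasCompactSupport
  tsupport_subset := (tsupport_add φ ψ).trans (Set.union_subset h.tsupport_subset
    h'.tsupport_subset)

theorem IsTestFunction.comp (h : IsTestFunction Ω φ) {Φ : ℝ → ℝ} (hΦ : ContDiff ℝ ∞ Φ)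
    (hΦ0 : Φ 0 = 0) : IsTestFunction Ω (fun x => Φ (φ x)) where
  contDiff := hΦ.comp h.contDiff
  hasCompactSupport := h.hasCompactSupport.comp_left hΦ0
  tsupport_subset := (tsupport_comp_subset hΦ0 φ).trans h.tsupport_subset

theorem IsTestFunction.zero : IsTestFunction Ω (fun _ => (0 : ℝ)) where
  contDiff := contDiff_const
  hasCompactSupport := HasCompactSupport.zero
  tsupport_subset := by simp [tsupport]

theorem IsTestFunction.gradient_add (h : IsTestFunction Ω φ) (h' : IsTestFunction Ω ψ)
    (x : EuclideanSpace ℝ (Fin N)) :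
    gradient (fun x => φ x + ψ x) x = gradient φ x + gradient ψ x := by
  refine HasGradientAt.gradient ?_
  rw [hasGradientAt_iff_hasFDerivAt, map_add]
  exact (h.hasGradientAt x).hasFDerivAt.add (h'.hasGradientAt x).hasFDerivAt

theorem IsTestFunction.gradient_comp (h : IsTestFunction Ω φ) {Φ : ℝ → ℝ} {c : ℝ}
    {x : EuclideanSpace ℝ (Fin N)} (hΦ : HasDerivAt Φ c (φ x)) :
    gradient (fun x => Φ (φ x)) x = c • gradient φ x := by
  refine HasGradientAt.gradient ?_
  rw [hasGradientAt_iff_hasFDerivAt, map_smul]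
  exact hΦ.comp_hasFDerivAt x (h.hasGradientAt x).hasFDerivAt

/-- Both integrands vanish off `Ω`, so the integration by parts takes place on the whole space and
the boundary of `Ω` plays no role. -/
theorem IsTestFunction.integral_smul_gradient (h : IsTestFunction Ω φ)
    (h' : IsTestFunction Ω ψ) :
    ∫ x in Ω, φ x • gradient ψ x = - ∫ x in Ω, ψ x • gradient φ x := by
  have key : ∀ {φ ψ : EuclideanSpace ℝ (Fin N) → ℝ}, IsTestFunction Ω φ → IsTestFunction Ω ψ →
      Integrable (fun x => φ x • gradient ψ x) ∧
        ∫ x in Ω, φ x • gradient ψ x = ∫ x, φ x • gradient ψ x := by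
    intro φ ψ h h'
    refine ⟨(h.contDiff.continuous.smul h'.continuous_gradient).integrable_of_hasCompactSupport
      h.hasCompactSupport.smul_right, setIntegral_eq_integral_of_forall_compl_eq_zero ?_⟩
    intro x hx
    rw [h.eq_zero_of_notMem hx, zero_smul]
  rw [(key h h').2, (key h' h).2]
  -- Pairing with a fixed vector `y` reduces the vector identity to a scalar one for the derivative
  -- in direction `y`.
  refine ext_inner_left ℝ fun y => ?_
  rw [inner_neg_right, ← integral_inner (key h h').1, ← integral_inner (key h' h).1]
  have e : ∀ {φ ψ : EuclideanSpace ℝ (Fin N) → ℝ} (x : EuclideanSpace ℝ (Fin N)),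
      ⟪y, φ x • gradient ψ x⟫ = φ x * fderiv ℝ ψ x y := by
    intro φ ψ x
    rw [real_inner_smul_right, real_inner_comm, inner_gradient_left]
  simp_rw [e]
  have hint : ∀ {φ ψ : EuclideanSpace ℝ (Fin N) → ℝ}, IsTestFunction Ω φ → IsTestFunction Ω ψ →
      Integrable (fun x => φ x * fderiv ℝ ψ x y) := by
    intro φ ψ h h'
    refine (h.contDiff.continuous.mul
      ((h'.contDiff.continuous_fderiv (by simp)).clm_apply continuous_const)
      ).integrable_of_hasCompactSupport h.hasCompactSupport.mul_right
  rw [integral_mul_fderiv_eq_neg_fderiv_mul_of_integrable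
    (by simpa only [mul_comm] using hint h' h) (hint h h')
    ((h.contDiff.continuous.mul h'.contDiff.continuous).integrable_of_hasCompactSupport
      h.hasCompactSupport.mul_right) (fun x _ => h.contDiff.differentiable (by simp) x)
    (fun x _ => h'.contDiff.differentiable (by simp) x)]
  simp_rw [mul_comm]

end TestFunction

/-! ### Passage to the limit in `L²` pairings. -/

section Integral

variable {X F : Type*} [MeasurableSpace X] {μ : Measure X} [NormedAddCommGroup F]
  [NormedSpace ℝ F]

theorem tendsto_integral_smul_of_tendsto_left {f : ℕ → X → ℝ} {f₀ : X → ℝ} {g : X → F}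
    (hf : ∀ k, MemLp (f k) 2 μ) (hf₀ : MemLp f₀ 2 μ) (hg : MemLp g 2 μ)
    (h : Tendsto (fun k => eLpNorm (fun x => f k x - f₀ x) 2 μ) atTop (𝓝 0)) :
    Tendsto (fun k => ∫ x, f k x • g x ∂μ) atTop (𝓝 (∫ x, f₀ x • g x ∂μ)) := by
  refine tendsto_integral_of_L1' _ (hf₀.1.smul hg.1)
    (.of_forall fun k => memLp_one_iff_integrable.1 (hg.smul (r := 1) (hf k))) ?_
  have h' : Tendsto (fun k => eLpNorm (fun x => f k x - f₀ x) 2 μ * eLpNorm g 2 μ) atTop (𝓝 0) := by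
    simpa using ENNReal.Tendsto.mul_const h (Or.inr hg.2.ne)
  refine tendsto_of_tendsto_of_tendsto_of_le_of_le tendsto_const_nhds h' (fun _ => zero_le) ?_
  intro k
  have := eLpNorm_smul_le_mul_eLpNorm (p := 2) (q := 2) (r := 1) hg.1 ((hf k).1.sub hf₀.1)
  have e : (f k - f₀) • g = (fun x => f k x • g x) - fun x => f₀ x • g x := by
    ext x
    simp [sub_smul]
  rw [e] at this
  exact this

theorem tendsto_integral_smul_of_tendsto_right {f : X → ℝ} {g : ℕ → X → F} {g₀ : X → F}
    (hf : MemLp f 2 μ) (hg : ∀ k, MemLp (g k) 2 μ) (hg₀ : MemLp g₀ 2 μ)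
    (h : Tendsto (fun k => eLpNorm (fun x => g k x - g₀ x) 2 μ) atTop (𝓝 0)) :
    Tendsto (fun k => ∫ x, f x • g k x ∂μ) atTop (𝓝 (∫ x, f x • g₀ x ∂μ)) := by
  refine tendsto_integral_of_L1' _ (hf.1.smul hg₀.1)
    (.of_forall fun k => memLp_one_iff_integrable.1 ((hg k).smul (r := 1) hf)) ?_
  have h' : Tendsto (fun k => eLpNorm f 2 μ * eLpNorm (fun x => g k x - g₀ x) 2 μ) atTop (𝓝 0) := by
    simpa using ENNReal.Tendsto.const_mul h (Or.inr hf.2.ne)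
  refine tendsto_of_tendsto_of_tendsto_of_le_of_le tendsto_const_nhds h' (fun _ => zero_le) ?_
  intro k
  have := eLpNorm_smul_le_mul_eLpNorm (p := 2) (q := 2) (r := 1) ((hg k).1.sub hg₀.1) hf.1
  have e : f • (g k - g₀) = (fun x => f x • g k x) - fun x => f x • g₀ x := by
    ext x
    simp [smul_sub]
  rw [e] at this
  exact this

end Integral

/-! ### `H¹₀` as a closed linear space. -/

section Closure

variable {u v : EuclideanSpace ℝ (Fin N) → ℝ}
  {g h : EuclideanSpace ℝ (Fin N) → EuclideanSpace ℝ (Fin N)}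

/-- Membership in `H¹₀` follows from approximation by test functions in `L²`. -/
theorem IsH10.of_approx [IsFiniteMeasure (volume.restrict Ω)]
    (hu : MemLp u 2 (volume.restrict Ω)) (hg : MemLp g 2 (volume.restrict Ω))
    {φ : ℕ → EuclideanSpace ℝ (Fin N) → ℝ} (hφ : ∀ k, IsTestFunction Ω (φ k))
    (h₁ : Tendsto (fun k => eLpNorm (fun x => φ k x - u x) 2 (volume.restrict Ω)) atTop (𝓝 0))
    (h₂ : Tendsto (fun k => eLpNorm (fun x => gradient (φ k) x - g x) 2 (volume.restrict Ω))
      atTop (𝓝 0)) : IsH10 Ω u g where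
  isH1 :=
    { memLp := hu
      memLp_grad := hg
      hasWeakGradient :=
        { locallyIntegrableOn :=
            IntegrableOn.locallyIntegrableOn (hu.integrable (by norm_num))
          locallyIntegrableOn_grad :=
            IntegrableOn.locallyIntegrableOn (hg.integrable (by norm_num))
          integral_eq := by
            intro η hη
            have e₁ : Tendsto (fun k => ∫ x in Ω, φ k x • gradient η x) atTop
                (𝓝 (∫ x in Ω, u x • gradient η x)) :=
              tendsto_integral_smul_of_tendsto_left (fun k => (hφ k).memLp 2) hu
                (hη.memLp_gradient 2) h₁
            have e₂ : Tendsto (fun k => ∫ x in Ω, η x • gradient (φ k) x) atTop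
                (𝓝 (∫ x in Ω, η x • g x)) :=
              tendsto_integral_smul_of_tendsto_right (hη.memLp 2)
                (fun k => (hφ k).memLp_gradient 2) hg h₂
            refine tendsto_nhds_unique e₁ ?_
            simpa only [(hφ _).integral_smul_gradient hη] using e₂.neg } }
  exists_approx := ⟨φ, hφ, h₁, h₂⟩

theorem IsH10.memLp (hu : IsH10 Ω u g) : MemLp u 2 (volume.restrict Ω) := hu.isH1.memLp

theorem IsH10.memLp_grad (hu : IsH10 Ω u g) : MemLp g 2 (volume.restrict Ω) :=
  hu.isH1.memLp_grad

theorem IsTestFunction.isH10 [IsFiniteMeasure (volume.restrict Ω)]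
    {φ : EuclideanSpace ℝ (Fin N) → ℝ} (hφ : IsTestFunction Ω φ) : IsH10 Ω φ (gradient φ) :=
  IsH10.of_approx (hφ.memLp 2) (hφ.memLp_gradient 2) (φ := fun _ => φ) (fun _ => hφ)
    (by simp) (by simp)

theorem IsH10.exists_test (hu : IsH10 Ω u g) {ε : ℝ≥0∞} (hε : 0 < ε) :
    ∃ φ, IsTestFunction Ω φ ∧ eLpNorm (fun x => φ x - u x) 2 (volume.restrict Ω) ≤ ε ∧
      eLpNorm (fun x => gradient φ x - g x) 2 (volume.restrict Ω) ≤ ε := by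
  obtain ⟨φ, hφ, h₁, h₂⟩ := hu.exists_approx
  obtain ⟨k, hk₁, hk₂⟩ := ((h₁.eventually (ge_mem_nhds hε)).and
    (h₂.eventually (ge_mem_nhds hε))).exists
  exact ⟨φ k, hφ k, hk₁, hk₂⟩

/-- `H¹₀` is sequentially closed. -/
theorem IsH10.of_tendsto [IsFiniteMeasure (volume.restrict Ω)]
    (hu : MemLp u 2 (volume.restrict Ω)) (hg : MemLp g 2 (volume.restrict Ω))
    {U : ℕ → EuclideanSpace ℝ (Fin N) → ℝ}
    {G : ℕ → EuclideanSpace ℝ (Fin N) → EuclideanSpace ℝ (Fin N)}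
    (hU : ∀ k, IsH10 Ω (U k) (G k))
    (h₁ : Tendsto (fun k => eLpNorm (fun x => U k x - u x) 2 (volume.restrict Ω)) atTop (𝓝 0))
    (h₂ : Tendsto (fun k => eLpNorm (fun x => G k x - g x) 2 (volume.restrict Ω))
      atTop (𝓝 0)) : IsH10 Ω u g := by
  -- Tolerances for the diagonal choice of test functions. For `k = 0` the inverse is `∞`, which is
  -- positive and imposes nothing.
  have hpos : ∀ k : ℕ, (0 : ℝ≥0∞) < (k : ℝ≥0∞)⁻¹ := fun k => by simp
  choose φ hφ a₁ a₂ using fun k => (hU k).exists_test (hpos k)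
  refine IsH10.of_approx hu hg hφ ?_ ?_
  · refine tendsto_of_tendsto_of_tendsto_of_le_of_le tendsto_const_nhds
      (by simpa using ENNReal.tendsto_inv_nat_nhds_zero.add h₁) (fun _ => zero_le) fun k => ?_
    refine le_trans (le_trans (le_of_eq ?_) (eLpNorm_add_le (((hφ k).memLp 2).1.sub (hU k).memLp.1)
      ((hU k).memLp.1.sub hu.1) (by norm_num))) (add_le_add_left (a₁ k) _)
    congr 1
    ext1 x
    simp
  · refine tendsto_of_tendsto_of_tendsto_of_le_of_le tendsto_const_nhds
      (by simpa using ENNReal.tendsto_inv_nat_nhds_zero.add h₂) (fun _ => zero_le) fun k => ?_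
    refine le_trans (le_trans (le_of_eq ?_) (eLpNorm_add_le
      (((hφ k).memLp_gradient 2).1.sub (hU k).memLp_grad.1)
      ((hU k).memLp_grad.1.sub hg.1) (by norm_num))) (add_le_add_left (a₂ k) _)
    congr 1
    ext1 x
    simp

theorem IsH10.congr_ae [IsFiniteMeasure (volume.restrict Ω)] (hu : IsH10 Ω u g)
    (h₁ : u =ᵐ[volume.restrict Ω] v) (h₂ : g =ᵐ[volume.restrict Ω] h) : IsH10 Ω v h := by
  refine IsH10.of_tendsto (hu.memLp.ae_eq h₁) (hu.memLp_grad.ae_eq h₂) (fun _ : ℕ => hu) ?_ ?_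
  · rw [eLpNorm_congr_ae (g := fun _ => (0 : ℝ)) (by filter_upwards [h₁] with x hx; simp [hx])]
    simp
  · rw [eLpNorm_congr_ae (g := fun _ => (0 : EuclideanSpace ℝ (Fin N)))
      (by filter_upwards [h₂] with x hx; simp [hx])]
    simp

theorem IsH10.zero [IsFiniteMeasure (volume.restrict Ω)] :
    IsH10 Ω (fun _ => 0) (fun _ => 0) := by
  have := (IsTestFunction.zero (Ω := Ω)).isH10
  rwa [gradient_fun_const'] at this

theorem IsH10.add [IsFiniteMeasure (volume.restrict Ω)] (hu : IsH10 Ω u g) (hv : IsH10 Ω v h) :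
    IsH10 Ω (fun x => u x + v x) (fun x => g x + h x) := by
  obtain ⟨φ, hφ, a₁, a₂⟩ := hu.exists_approx
  obtain ⟨ψ, hψ, b₁, b₂⟩ := hv.exists_approx
  refine IsH10.of_approx (hu.memLp.add hv.memLp) (hu.memLp_grad.add hv.memLp_grad)
    (fun k => (hφ k).add (hψ k)) ?_ ?_
  · refine tendsto_of_tendsto_of_tendsto_of_le_of_le tendsto_const_nhds
      (by simpa using a₁.add b₁) (fun _ => zero_le) fun k => ?_
    refine le_trans (le_of_eq ?_) (eLpNorm_add_le (((hφ k).memLp 2).1.sub hu.memLp.1)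
      (((hψ k).memLp 2).1.sub hv.memLp.1) (by norm_num))
    congr 1
    ext1 x
    simp only [Pi.add_apply]
    ring
  · refine tendsto_of_tendsto_of_tendsto_of_le_of_le tendsto_const_nhds
      (by simpa using a₂.add b₂) (fun _ => zero_le) fun k => ?_
    refine le_trans (le_of_eq ?_) (eLpNorm_add_le
      (((hφ k).memLp_gradient 2).1.sub hu.memLp_grad.1)
      (((hψ k).memLp_gradient 2).1.sub hv.memLp_grad.1) (by norm_num))
    congr 1
    ext1 x
    simp only [Pi.add_apply, (hφ k).gradient_add (hψ k)]
    abel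

theorem IsH10.const_smul [IsFiniteMeasure (volume.restrict Ω)] (c : ℝ) (hu : IsH10 Ω u g) :
    IsH10 Ω (fun x => c * u x) (fun x => c • g x) := by
  obtain ⟨φ, hφ, a₁, a₂⟩ := hu.exists_approx
  refine IsH10.of_approx (hu.memLp.const_mul c) (hu.memLp_grad.const_smul c)
    (fun k => (hφ k).comp (Φ := fun s => c * s) (contDiff_const.mul contDiff_id) (by simp)) ?_ ?_
  · have : ∀ k, eLpNorm (fun x => c * φ k x - c * u x) 2 (volume.restrict Ω)
        = ‖c‖ₑ * eLpNorm (fun x => φ k x - u x) 2 (volume.restrict Ω) := fun k => by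
      rw [← eLpNorm_const_smul]
      congr 1
      ext1 x
      simp [mul_sub]
    simpa [this] using ENNReal.Tendsto.const_mul a₁ (Or.inr enorm_ne_top)
  · have : ∀ k, eLpNorm (fun x => gradient (fun x => c * φ k x) x - c • g x) 2
        (volume.restrict Ω)
        = ‖c‖ₑ * eLpNorm (fun x => gradient (φ k) x - g x) 2 (volume.restrict Ω) := fun k => by
      rw [← eLpNorm_const_smul]
      congr 1
      ext1 x
      rw [(hφ k).gradient_comp (Φ := fun s => c * s) (c := c)
        (by simpa using (hasDerivAt_id (φ k x)).const_mul c)]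
      simp [smul_sub]
    simpa [this] using ENNReal.Tendsto.const_mul a₂ (Or.inr enorm_ne_top)

end Closure

/-! ### Chain rule and truncation in `H¹₀`. -/

/-- Dominated convergence in `L²`. -/
theorem tendsto_eLpNorm_two_zero_of_dominated {X F : Type*} [MeasurableSpace X] {μ : Measure X}
    [NormedAddCommGroup F] {f : ℕ → X → F} {b : X → ℝ}
    (hf : ∀ k, AEStronglyMeasurable (f k) μ) (hb : MemLp b 2 μ)
    (hfb : ∀ k, ∀ᵐ x ∂μ, ‖f k x‖ ≤ b x)
    (hlim : ∀ᵐ x ∂μ, Tendsto (fun k => f k x) atTop (𝓝 0)) :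
    Tendsto (fun k => eLpNorm (f k) 2 μ) atTop (𝓝 0) := by
  have key : Tendsto (fun k => ∫⁻ x, ‖f k x‖ₑ ^ (2 : ℝ) ∂μ) atTop (𝓝 (∫⁻ _, 0 ∂μ)) := by
    refine tendsto_lintegral_of_dominated_convergence' (fun x => ‖b x‖ₑ ^ (2 : ℝ))
      (fun k => (hf k).enorm.pow_const _) (fun k => ?_) ?_ ?_
    · filter_upwards [hfb k] with x hx
      refine ENNReal.rpow_le_rpow ?_ (by norm_num)
      rw [← ofReal_norm, ← ofReal_norm]
      exact ENNReal.ofReal_le_ofReal (hx.trans (Real.le_norm_self _))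
    · simpa using (lintegral_rpow_enorm_lt_top_of_eLpNorm_lt_top (by norm_num) (by norm_num)
        hb.2).ne
    · filter_upwards [hlim] with x hx
      have := ((ENNReal.continuous_rpow_const (y := 2)).tendsto _).comp hx.enorm
      simpa [Function.comp_def] using this
  have := ((ENNReal.continuous_rpow_const (y := 1 / 2)).tendsto _).comp key
  simpa [eLpNorm_eq_lintegral_rpow_enorm_toReal, Function.comp_def] using this

/-- Chain rule for test functions and `C¹` maps. -/
theorem IsTestFunction.isH10_comp [IsFiniteMeasure (volume.restrict Ω)]
    {φ : EuclideanSpace ℝ (Fin N) → ℝ} (hφ : IsTestFunction Ω φ) {Φ Φ' : ℝ → ℝ}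
    (hΦ : ∀ s, HasDerivAt Φ (Φ' s) s) (hΦ' : Continuous Φ') (hΦ0 : Φ 0 = 0) :
    IsH10 Ω (fun x => Φ (φ x)) (fun x => Φ' (φ x) • gradient φ x) := by
  obtain ⟨M, hM⟩ := hφ.hasCompactSupport.exists_bound_of_continuous hφ.contDiff.continuous
  have hM0 : 0 ≤ M := (norm_nonneg _).trans (hM 0)
  have hmem : ∀ x, φ x ∈ Set.Icc (-M) M := fun x => abs_le.1 (hM x)
  -- `Φ ∘ φ` is only `C¹`, hence not a test function. Weierstrass approximation of `Φ'` on the range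
  -- of `φ`, followed by integration from `0`, gives smooth `Q k` close to `Φ` in `C¹([-M, M])`.
  choose P hP using fun k : ℕ => exists_polynomial_near_of_continuousOn (-M) M Φ'
    hΦ'.continuousOn (1 / ((k : ℝ) + 1)) (by positivity)
  set Q : ℕ → ℝ → ℝ := fun k s => ∫ t in (0 : ℝ)..s, (P k).eval t with hQ
  have hQd : ∀ k s, HasDerivAt (Q k) ((P k).eval s) s := fun k s =>
    intervalIntegral.integral_hasDerivAt_right ((P k).continuous.intervalIntegrable _ _)
      ((P k).continuous.stronglyMeasurableAtFilter _ _) (P k).continuous.continuousAt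
  have hQs : ∀ k, ContDiff ℝ ∞ (Q k) := fun k => by
    rw [contDiff_infty_iff_deriv]
    refine ⟨fun s => (hQd k s).differentiableAt, ?_⟩
    rw [show deriv (Q k) = fun s => (P k).eval s from funext fun s => (hQd k s).deriv]
    simpa only [Polynomial.coe_aeval_eq_eval] using (P k).contDiff_aeval (𝕜 := ℝ) ∞
  have hQ0 : ∀ k, Q k 0 = 0 := fun k => by simp [hQ]
  have hεle : ∀ k : ℕ, 1 / ((k : ℝ) + 1) ≤ 1 := fun k => by
    rw [div_le_one (by positivity)]; linarith [k.cast_nonneg (α := ℝ)]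
  have hQΦ : ∀ k, ∀ s ∈ Set.Icc (-M) M, |Q k s - Φ s| ≤ 1 / ((k : ℝ) + 1) * M := by
    intro k s hs
    have := (convex_Icc (-M) M).norm_image_sub_le_of_norm_hasDerivWithin_le
      (f := fun s => Q k s - Φ s) (f' := fun s => (P k).eval s - Φ' s)
      (C := 1 / ((k : ℝ) + 1)) (fun t _ => ((hQd k t).sub (hΦ t)).hasDerivWithinAt)
      (fun t ht => (hP k t ht).le) (x := 0) (y := s) ⟨by linarith, hM0⟩ hs
    simp only [hQ0, hΦ0, sub_zero, Real.norm_eq_abs] at this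
    exact this.trans (mul_le_mul_of_nonneg_left (abs_le.2 hs) (by positivity))
  have hΦc : Continuous Φ := continuous_iff_continuousAt.2 fun s => (hΦ s).continuousAt
  have hgrad : ∀ k x, gradient (fun x => Q k (φ x)) x = (P k).eval (φ x) • gradient φ x :=
    fun k x => hφ.gradient_comp (hQd k _)
  have htest : ∀ k, IsTestFunction Ω (fun x => Q k (φ x)) := fun k => hφ.comp (hQs k) (hQ0 k)
  have hm₁ : AEStronglyMeasurable (fun x => Φ (φ x)) (volume.restrict Ω) :=
    (hΦc.comp hφ.contDiff.continuous).aestronglyMeasurable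
  have hm₂ : AEStronglyMeasurable (fun x => Φ' (φ x) • gradient φ x) (volume.restrict Ω) :=
    ((hΦ'.comp hφ.contDiff.continuous).smul hφ.continuous_gradient).aestronglyMeasurable
  have hlim := tendsto_one_div_add_atTop_nhds_zero_nat (𝕜 := ℝ)
  obtain ⟨C₁, hC₁⟩ := isCompact_Icc.exists_bound_of_continuousOn (s := Set.Icc (-M) M)
    hΦc.continuousOn
  obtain ⟨C₂, hC₂⟩ := isCompact_Icc.exists_bound_of_continuousOn (s := Set.Icc (-M) M)
    hΦ'.continuousOn
  refine IsH10.of_approx (MemLp.of_bound hm₁ C₁ (.of_forall fun x => hC₁ _ (hmem x)))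
    ((hφ.memLp_gradient 2).of_le_mul (c := C₂) hm₂ (.of_forall fun x => ?_)) htest ?_ ?_
  · rw [norm_smul]
    exact mul_le_mul_of_nonneg_right (hC₂ _ (hmem x)) (norm_nonneg _)
  · refine tendsto_eLpNorm_two_zero_of_dominated (b := fun _ => M)
      (fun k => ((htest k).memLp 2).1.sub hm₁) (memLp_const M) (fun k => .of_forall fun x => ?_)
      (.of_forall fun x => ?_)
    · exact (hQΦ k _ (hmem x)).trans (mul_le_of_le_one_left hM0 (hεle k))
    · exact squeeze_zero_norm (fun k => hQΦ k _ (hmem x)) (by simpa using hlim.mul_const M)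
  · have hb : ∀ k x, ‖gradient (fun x => Q k (φ x)) x - Φ' (φ x) • gradient φ x‖
        ≤ 1 / ((k : ℝ) + 1) * ‖gradient φ x‖ := by
      intro k x
      rw [hgrad, ← sub_smul, norm_smul]
      exact mul_le_mul_of_nonneg_right (hP k _ (hmem x)).le (norm_nonneg _)
    refine tendsto_eLpNorm_two_zero_of_dominated (b := fun x => ‖gradient φ x‖)
      (fun k => ((htest k).memLp_gradient 2).1.sub hm₂) (hφ.memLp_gradient 2).norm
      (fun k => .of_forall fun x => ?_) (.of_forall fun x => ?_)
    · exact (hb k x).trans (mul_le_of_le_one_left (norm_nonneg _) (hεle k))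
    · exact squeeze_zero_norm (fun k => hb k x) (by simpa using hlim.mul_const ‖gradient φ x‖)

variable {u : EuclideanSpace ℝ (Fin N) → ℝ}
  {g : EuclideanSpace ℝ (Fin N) → EuclideanSpace ℝ (Fin N)}

/-- Passing to a subsequence gives pointwise convergence, which is what continuity of `Φ'` and
Fatou's lemma can use. -/
theorem IsH10.exists_approx_ae (hu : IsH10 Ω u g) :
    ∃ φ : ℕ → EuclideanSpace ℝ (Fin N) → ℝ, (∀ k, IsTestFunction Ω (φ k)) ∧
      Tendsto (fun k => eLpNorm (fun x => φ k x - u x) 2 (volume.restrict Ω)) atTop (𝓝 0) ∧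
      Tendsto (fun k => eLpNorm (fun x => gradient (φ k) x - g x) 2 (volume.restrict Ω))
        atTop (𝓝 0) ∧
      ∀ᵐ x ∂(volume.restrict Ω), Tendsto (fun k => φ k x) atTop (𝓝 (u x)) := by
  obtain ⟨φ, hφ, h₁, h₂⟩ := hu.exists_approx
  obtain ⟨ns, hns, hae⟩ := (tendstoInMeasure_of_tendsto_eLpNorm (p := 2) (by norm_num)
    (fun k => ((hφ k).memLp 2).1) hu.memLp.1 h₁).exists_seq_tendsto_ae
  exact ⟨fun k => φ (ns k), fun k => hφ _, h₁.comp hns.tendsto_atTop,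
    h₂.comp hns.tendsto_atTop, hae⟩

/-- Chain rule in `H¹₀` for `C¹` maps with bounded derivative. -/
theorem IsH10.comp [IsFiniteMeasure (volume.restrict Ω)] (hu : IsH10 Ω u g) {Φ Φ' : ℝ → ℝ}
    (hΦ : ∀ s, HasDerivAt Φ (Φ' s) s) (hΦ' : Continuous Φ') (hΦ0 : Φ 0 = 0) {L : ℝ}
    (hL : ∀ s, |Φ' s| ≤ L) :
    IsH10 Ω (fun x => Φ (u x)) (fun x => Φ' (u x) • g x) := by
  obtain ⟨φ, hφ, h₁, h₂, hae⟩ := hu.exists_approx_ae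
  have hΦc : Continuous Φ := continuous_iff_continuousAt.2 fun s => (hΦ s).continuousAt
  have hlip : ∀ s t, |Φ s - Φ t| ≤ L * |s - t| := fun s t =>
    convex_univ.norm_image_sub_le_of_norm_hasDerivWithin_le
      (fun t _ => (hΦ t).hasDerivWithinAt) (fun t _ => hL t) (Set.mem_univ t) (Set.mem_univ s)
  have hm₁ : AEStronglyMeasurable (fun x => Φ (u x)) (volume.restrict Ω) :=
    hΦc.comp_aestronglyMeasurable hu.memLp.1
  have hm₀ : AEStronglyMeasurable (fun x => Φ' (u x)) (volume.restrict Ω) :=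
    hΦ'.comp_aestronglyMeasurable hu.memLp.1
  have hmφ : ∀ k, AEStronglyMeasurable (fun x => Φ' (φ k x)) (volume.restrict Ω) := fun k =>
    hΦ'.comp_aestronglyMeasurable ((hφ k).memLp 2).1
  refine IsH10.of_tendsto (hu.memLp.of_le_mul (c := L) hm₁ (.of_forall fun x => ?_))
    (hu.memLp_grad.of_le_mul (c := L) (hm₀.smul hu.memLp_grad.1) (.of_forall fun x => ?_))
    (fun k => (hφ k).isH10_comp hΦ hΦ' hΦ0) ?_ ?_
  · simpa [hΦ0] using hlip (u x) 0
  · rw [norm_smul]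
    exact mul_le_mul_of_nonneg_right (hL _) (norm_nonneg _)
  · refine tendsto_of_tendsto_of_tendsto_of_le_of_le tendsto_const_nhds
      (by simpa using ENNReal.Tendsto.const_mul h₁ (Or.inr ENNReal.ofReal_ne_top))
      (fun _ => zero_le) fun k => eLpNorm_le_mul_eLpNorm_of_ae_le_mul (c := L)
      (.of_forall fun x => hlip (φ k x) (u x)) 2
  -- The gradient error splits as `Φ'(φ_k)(∇φ_k - g) + (Φ'(φ_k) - Φ'(u)) g`. The first term is small
  -- because `Φ'` is bounded, the second by dominated convergence.
  · have a₁ : Tendsto (fun k => eLpNorm (fun x => Φ' (φ k x) • (gradient (φ k) x - g x)) 2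
        (volume.restrict Ω)) atTop (𝓝 0) := by
      refine tendsto_of_tendsto_of_tendsto_of_le_of_le tendsto_const_nhds
        (by simpa using ENNReal.Tendsto.const_mul h₂ (Or.inr ENNReal.ofReal_ne_top))
        (fun _ => zero_le) fun k => eLpNorm_le_mul_eLpNorm_of_ae_le_mul (c := L)
        (.of_forall fun x => ?_) 2
      rw [norm_smul]
      exact mul_le_mul_of_nonneg_right (hL _) (norm_nonneg _)
    have a₂ : Tendsto (fun k => eLpNorm (fun x => (Φ' (φ k x) - Φ' (u x)) • g x) 2
        (volume.restrict Ω)) atTop (𝓝 0) := by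
      refine tendsto_eLpNorm_two_zero_of_dominated (b := fun x => (2 * L) * ‖g x‖)
        (fun k => ((hmφ k).sub hm₀).smul hu.memLp_grad.1)
        (hu.memLp_grad.norm.const_mul (2 * L)) (fun k => .of_forall fun x => ?_) ?_
      · rw [norm_smul]
        refine mul_le_mul_of_nonneg_right ((norm_sub_le _ _).trans ?_) (norm_nonneg _)
        linarith [hL (φ k x), hL (u x), Real.norm_eq_abs (Φ' (φ k x)),
          Real.norm_eq_abs (Φ' (u x))]
      · filter_upwards [hae] with x hx
        have := ((((hΦ'.tendsto _).comp hx).sub_const (Φ' (u x))).smul_const (g x))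
        simpa [Function.comp_def] using this
    refine tendsto_of_tendsto_of_tendsto_of_le_of_le tendsto_const_nhds
      (by simpa using a₁.add a₂) (fun _ => zero_le) fun k => ?_
    refine le_trans (le_of_eq ?_) (eLpNorm_add_le
      ((hmφ k).smul (((hφ k).memLp_gradient 2).1.sub hu.memLp_grad.1))
      (((hmφ k).sub hm₀).smul hu.memLp_grad.1) (by norm_num))
    congr 1
    ext1 x
    simp [smul_sub, sub_smul]

/-- Chain rule in `H¹₀` for Lipschitz maps whose derivative is a bounded pointwise limit of
continuous functions. -/
theorem IsH10.comp_integral [IsFiniteMeasure (volume.restrict Ω)] (hu : IsH10 Ω u g)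
    {ψ : ℕ → ℝ → ℝ} {χ : ℝ → ℝ} (hψ : ∀ j, Continuous (ψ j)) {L : ℝ} (hL : ∀ j s, |ψ j s| ≤ L)
    (hlim : ∀ s, Tendsto (fun j => ψ j s) atTop (𝓝 (χ s))) :
    IsH10 Ω (fun x => ∫ t in (0 : ℝ)..u x, χ t) (fun x => χ (u x) • g x) := by
  have hχL : ∀ s, |χ s| ≤ L := fun s => le_of_tendsto' (hlim s).abs fun j => hL j s
  have hB : ∀ {η : ℝ → ℝ}, (∀ s, |η s| ≤ L) → ∀ s, |∫ t in (0 : ℝ)..s, η t| ≤ L * |s| := by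
    intro η hη s
    simpa using intervalIntegral.norm_integral_le_of_norm_le_const (a := 0) (b := s)
      (f := η) (C := L) (fun t _ => hη t)
  have hint : ∀ s, Tendsto (fun j => ∫ t in (0 : ℝ)..s, ψ j t) atTop
      (𝓝 (∫ t in (0 : ℝ)..s, χ t)) := fun s =>
    intervalIntegral.tendsto_integral_filter_of_dominated_convergence (fun _ => L)
      (.of_forall fun j => (hψ j).aestronglyMeasurable)
      (.of_forall fun j => .of_forall fun t _ => hL j t) intervalIntegrable_const
      (.of_forall fun t _ => hlim t)
  have hmem : ∀ j, IsH10 Ω (fun x => ∫ t in (0 : ℝ)..u x, ψ j t) (fun x => ψ j (u x) • g x) :=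
    fun j => hu.comp (Φ := fun s => ∫ t in (0 : ℝ)..s, ψ j t) (fun s =>
      intervalIntegral.integral_hasDerivAt_right ((hψ j).intervalIntegrable _ _)
      ((hψ j).stronglyMeasurableAtFilter _ _) (hψ j).continuousAt) (hψ j) (by simp) (hL j)
  have hm₁ : AEStronglyMeasurable (fun x => ∫ t in (0 : ℝ)..u x, χ t) (volume.restrict Ω) :=
    aestronglyMeasurable_of_tendsto_ae atTop (fun j => (hmem j).memLp.1)
      (.of_forall fun x => hint (u x))
  have hm₂ : AEStronglyMeasurable (fun x => χ (u x) • g x) (volume.restrict Ω) :=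
    aestronglyMeasurable_of_tendsto_ae atTop (fun j => (hmem j).memLp_grad.1)
      (.of_forall fun x => (hlim (u x)).smul_const _)
  refine IsH10.of_tendsto (hu.memLp.of_le_mul (c := L) hm₁ (.of_forall fun x => hB hχL _))
    (hu.memLp_grad.of_le_mul (c := L) hm₂ (.of_forall fun x => ?_)) hmem ?_ ?_
  · rw [norm_smul]
    exact mul_le_mul_of_nonneg_right (hχL _) (norm_nonneg _)
  · refine tendsto_eLpNorm_two_zero_of_dominated (b := fun x => (2 * L) * ‖u x‖)
      (fun k => (hmem k).memLp.1.sub hm₁)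
      (hu.memLp.norm.const_mul (2 * L)) (fun k => .of_forall fun x => ?_) (.of_forall fun x => ?_)
    · refine (norm_sub_le _ _).trans ?_
      have := hB hχL (u x)
      have := hB (hL k) (u x)
      simp only [Real.norm_eq_abs]
      linarith
    · simpa using (hint (u x)).sub_const (∫ t in (0 : ℝ)..u x, χ t)
  · refine tendsto_eLpNorm_two_zero_of_dominated (b := fun x => (2 * L) * ‖g x‖)
      (fun k => (hmem k).memLp_grad.1.sub hm₂)
      (hu.memLp_grad.norm.const_mul (2 * L)) (fun k => .of_forall fun x => ?_)
      (.of_forall fun x => ?_)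
    · rw [← sub_smul, norm_smul]
      refine mul_le_mul_of_nonneg_right ((norm_sub_le _ _).trans ?_) (norm_nonneg _)
      linarith [hL k (u x), hχL (u x), Real.norm_eq_abs (ψ k (u x)), Real.norm_eq_abs (χ (u x))]
    · simpa using ((hlim (u x)).smul_const (g x)).sub_const (χ (u x) • g x)

/-- Because `k ≥ 0`, the base point `0` lies where the truncation is flat, so there is no additive
constant. -/
theorem integral_indicator_Ioi_eq_max {k : ℝ} (hk : 0 ≤ k) (s : ℝ) :
    ∫ t in (0 : ℝ)..s, (if k < t then (1 : ℝ) else 0) = max (s - k) 0 := by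
  have hz : ∀ {r : ℝ}, r ≤ k → ∫ t in (0 : ℝ)..r, (if k < t then (1 : ℝ) else 0) = 0 := by
    intro r hr
    rw [intervalIntegral.integral_congr_ae (g := fun _ => (0 : ℝ))]
    · simp
    · refine .of_forall fun t ht => if_neg ?_
      rw [Set.uIoc, Set.mem_Ioc] at ht
      exact not_lt.2 (ht.2.trans (max_le hk hr))
  rcases le_total s k with h | h
  · rw [hz h, max_eq_right (by linarith)]
  · have e : ∀ t ∈ Set.uIoc k s, (1 : ℝ) = (if k < t then (1 : ℝ) else 0) := by
      intro t ht
      rw [Set.uIoc_of_le h] at ht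
      rw [if_pos ht.1]
    have i₁ : IntervalIntegrable (fun t => if k < t then (1 : ℝ) else 0) volume k s :=
      (intervalIntegrable_const (c := (1 : ℝ))).congr e
    have i₀ : IntervalIntegrable (fun t => if k < t then (1 : ℝ) else 0) volume 0 k := by
      refine (intervalIntegrable_const (c := (0 : ℝ))).congr fun t ht => ?_
      rw [Set.uIoc_of_le hk] at ht
      rw [if_neg (not_lt.2 ht.2)]
    rw [← intervalIntegral.integral_add_adjacent_intervals i₀ i₁, hz le_rfl,
      ← intervalIntegral.integral_congr_ae (.of_forall e), max_eq_left (by linarith)]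
    simp

/-- Truncation from below in `H¹₀`. -/
theorem IsH10.max_sub [IsFiniteMeasure (volume.restrict Ω)] (hu : IsH10 Ω u g) {k : ℝ}
    (hk : 0 ≤ k) :
    IsH10 Ω (fun x => max (u x - k) 0) (fun x => (if k < u x then (1 : ℝ) else 0) • g x) := by
  -- The ramps vanish at `s = k`, so their limit there is `0`: the strict inequality in the
  -- indicator comes from this.
  have := hu.comp_integral (ψ := fun j s => min 1 (j * max (s - k) 0))
    (χ := fun s => if k < s then (1 : ℝ) else 0) (L := 1) (fun j => by fun_prop)
    (fun j s => ?_) (fun s => ?_)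
  · simpa only [integral_indicator_Ioi_eq_max hk] using this
  · rw [abs_le]
    exact ⟨le_trans (by norm_num) (le_min zero_le_one (by positivity)), min_le_left _ _⟩
  · split_ifs with h
    · refine tendsto_const_nhds.congr' ?_
      obtain ⟨J, hJ⟩ := exists_nat_ge (1 / (s - k))
      filter_upwards [eventually_ge_atTop J] with j hj
      have hs : 0 < s - k := by linarith
      rw [max_eq_left hs.le, min_eq_left]
      rw [div_le_iff₀ hs] at hJ
      exact hJ.trans (mul_le_mul_of_nonneg_right (by exact_mod_cast hj) hs.le)
    · simp [max_eq_right (show s - k ≤ 0 by linarith)]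

/-! ### Sobolev's inequality. -/

/-- This is the Gagliardo–Nirenberg–Sobolev inequality on the whole space; `φ` and its gradient are
supported in `Ω`, so restricting the measure changes neither norm. -/
theorem IsTestFunction.exists_eLpNorm_le (hN : 3 ≤ N) (hΩb : Bornology.IsBounded Ω) {q : NNReal}
    (hq : (2 : ℝ)⁻¹ - (N : ℝ)⁻¹ ≤ (q : ℝ)⁻¹) :
    ∃ C : NNReal, ∀ φ, IsTestFunction Ω φ →
      eLpNorm φ q (volume.restrict Ω) ≤ C * eLpNorm (gradient φ) 2 (volume.restrict Ω) := by
  refine ⟨eLpNormLESNormFDerivOfLeConst ℝ (volume : Measure (EuclideanSpace ℝ (Fin N))) Ω 2 q,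
    fun φ hφ => ?_⟩
  have hsupp : Function.support φ ⊆ Ω := (subset_tsupport φ).trans hφ.tsupport_subset
  have h := eLpNorm_le_eLpNorm_fderiv_of_le (F := ℝ) (volume : Measure (EuclideanSpace ℝ (Fin N)))
    (hφ.contDiff.of_le (by simp)) hsupp (p := 2) (q := q) (by norm_num)
    (by rw [finrank_euclideanSpace_fin]; exact_mod_cast (by omega : 2 < N))
    (by simpa using hq) hΩb
  have e₁ : eLpNorm (gradient φ) 2 (volume.restrict Ω) = eLpNorm (fderiv ℝ φ) 2 volume := by
    rw [eLpNorm_restrict_eq_of_support_subset]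
    · refine eLpNorm_congr_norm_ae (.of_forall fun x => ?_)
      rw [← toDual_gradient, LinearIsometryEquiv.norm_map]
    · refine fun x hx => hφ.tsupport_subset (support_fderiv_subset ℝ ?_)
      intro h0
      refine hx ?_
      rw [gradient, h0, map_zero]
  rw [e₁, eLpNorm_restrict_eq_of_support_subset hsupp]
  exact_mod_cast h

/-- Sobolev's inequality in `H¹₀`. -/
theorem exists_sobolev_const (hN : 3 ≤ N) (hΩb : Bornology.IsBounded Ω) {q : NNReal}
    (hq : (2 : ℝ)⁻¹ - (N : ℝ)⁻¹ ≤ (q : ℝ)⁻¹) :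
    ∃ C : NNReal, ∀ u g, IsH10 Ω u g →
      eLpNorm u q (volume.restrict Ω) ≤ C * eLpNorm g 2 (volume.restrict Ω) := by
  obtain ⟨C, hC⟩ := IsTestFunction.exists_eLpNorm_le hN hΩb hq
  refine ⟨C, fun u g hu => ?_⟩
  obtain ⟨φ, hφ, -, h₂, hae⟩ := hu.exists_approx_ae
  have hlim : Tendsto (fun k => C * (eLpNorm (fun x => gradient (φ k) x - g x) 2
      (volume.restrict Ω) + eLpNorm g 2 (volume.restrict Ω))) atTop
      (𝓝 (C * eLpNorm g 2 (volume.restrict Ω))) := by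
    simpa using ENNReal.Tendsto.const_mul (a := (C : ℝ≥0∞))
      (h₂.add_const (eLpNorm g 2 (volume.restrict Ω))) (Or.inr ENNReal.coe_ne_top)
  -- Convergence in `L^q` is not known for the approximants, but a.e. convergence and Fatou's lemma
  -- suffice.
  refine (Lp.eLpNorm_lim_le_liminf_eLpNorm (fun k => ((hφ k).memLp 2).1) u hae).trans ?_
  rw [← hlim.liminf_eq]
  refine liminf_le_liminf (.of_forall fun k => (hC _ (hφ k)).trans ?_)
  gcongr
  refine le_trans (le_of_eq ?_) (eLpNorm_add_le
    (((hφ k).memLp_gradient 2).1.sub hu.memLp_grad.1) hu.memLp_grad.1 (by norm_num))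
  congr 1
  ext1 x
  simp

/-! ### Monotone operators and the semilinear problem. -/

/-- A strongly monotone Lipschitz map on a Hilbert space has a zero. -/
theorem exists_zero_of_stronglyMonotone {H : Type*} [NormedAddCommGroup H]
    [InnerProductSpace ℝ H] [CompleteSpace H] (A : H → H) {c L : ℝ} (hc : 0 < c) (hL : 0 ≤ L)
    (hmono : ∀ x y, c * ‖x - y‖ ^ 2 ≤ ⟪A x - A y, x - y⟫)
    (hlip : ∀ x y, ‖A x - A y‖ ≤ L * ‖x - y‖) : ∃ x, A x = 0 := by
  -- Enlarging the Lipschitz constant ensures `0 < c ≤ M`, so that `1 - c² / M²` is nonnegative and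
  -- less than `1`.
  set M := L + c with hM
  have hM0 : 0 < M := by positivity
  have hcM : c ^ 2 / M ^ 2 ≤ 1 := by
    rw [div_le_one (by positivity)]
    exact pow_le_pow_left₀ hc.le (by linarith) 2
  -- The map `x ↦ x - t A x` has squared Lipschitz constant at most `1 - 2tc + t²M²`; this `t`
  -- minimises it, with value `1 - c² / M²`.
  set t := c / M ^ 2 with ht
  have ht0 : 0 < t := by positivity
  set K : NNReal := ⟨Real.sqrt (1 - c ^ 2 / M ^ 2), Real.sqrt_nonneg _⟩ with hK
  have hK1 : K < 1 := by
    rw [← NNReal.coe_lt_coe]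
    change Real.sqrt _ < 1
    rw [Real.sqrt_lt' one_pos]
    have : 0 < c ^ 2 / M ^ 2 := by positivity
    linarith
  have hcontr : ContractingWith K (fun x => x - t • A x) := by
    refine ⟨hK1, LipschitzWith.of_dist_le_mul fun x y => ?_⟩
    rw [dist_eq_norm, dist_eq_norm]
    refine (sq_le_sq₀ (norm_nonneg _) (by positivity)).1 ?_
    have e : x - t • A x - (y - t • A y) = (x - y) - t • (A x - A y) := by
      rw [smul_sub]; abel
    have hK2 : (K : ℝ) ^ 2 = 1 - c ^ 2 / M ^ 2 := Real.sq_sqrt (by linarith)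
    rw [e, norm_sub_sq_real, mul_pow, hK2, real_inner_smul_right, norm_smul, mul_pow,
      Real.norm_eq_abs, sq_abs, real_inner_comm]
    have h₁ := mul_le_mul_of_nonneg_left (hmono x y) ht0.le
    have h₂ : ‖A x - A y‖ ^ 2 ≤ M ^ 2 * ‖x - y‖ ^ 2 := by
      rw [← mul_pow]
      exact pow_le_pow_left₀ (norm_nonneg _) ((hlip x y).trans
        (mul_le_mul_of_nonneg_right (by linarith) (norm_nonneg _))) 2
    have h₃ := mul_le_mul_of_nonneg_left h₂ (sq_nonneg t)
    have e₁ : t ^ 2 * (M ^ 2 * ‖x - y‖ ^ 2) = c ^ 2 / M ^ 2 * ‖x - y‖ ^ 2 := by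
      rw [ht]; field_simp
    have e₂ : t * (c * ‖x - y‖ ^ 2) = c ^ 2 / M ^ 2 * ‖x - y‖ ^ 2 := by
      rw [ht]; field_simp
    rw [e₁] at h₃
    rw [e₂] at h₁
    linarith
  obtain ⟨x, hx⟩ : ∃ x, x - t • A x = x := ⟨_, hcontr.fixedPoint_isFixedPt⟩
  exact ⟨x, by simpa [ht0.ne'] using hx⟩

/-- Solvability of the variational problem of a strongly monotone Lipschitz map on a complete
subspace. -/
theorem exists_orthogonal_of_stronglyMonotone {H : Type*} [NormedAddCommGroup H]
    [InnerProductSpace ℝ H] (K : Submodule ℝ H) [CompleteSpace K] (S : H → H) {c L : ℝ}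
    (hc : 0 < c) (hL : 0 ≤ L) (hmono : ∀ x ∈ K, ∀ y ∈ K, c * ‖x - y‖ ^ 2 ≤ ⟪S x - S y, x - y⟫)
    (hlip : ∀ x ∈ K, ∀ y ∈ K, ‖S x - S y‖ ≤ L * ‖x - y‖) : ∃ x ∈ K, ∀ y ∈ K, ⟪S x, y⟫ = 0 := by
  have h₁ : ∀ x y : K, c * ‖x - y‖ ^ 2 ≤
      ⟪K.orthogonalProjectionOnto (S x) - K.orthogonalProjectionOnto (S y), x - y⟫ := by
    intro x y
    rw [← map_sub, Submodule.inner_orthogonalProjectionOnto_eq_of_mem_right]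
    exact hmono x x.2 y y.2
  have h₂ : ∀ x y : K,
      ‖K.orthogonalProjectionOnto (S x) - K.orthogonalProjectionOnto (S y)‖ ≤ L * ‖x - y‖ := by
    intro x y
    rw [← map_sub]
    exact (K.norm_orthogonalProjectionOnto_apply_le _).trans (hlip x x.2 y y.2)
  obtain ⟨x, hx⟩ := exists_zero_of_stronglyMonotone _ hc hL h₁ h₂
  refine ⟨x, x.2, fun y hy => ?_⟩
  rw [Submodule.orthogonalProjectionOnto_eq_zero_iff] at hx
  exact Submodule.inner_left_of_mem_orthogonal hy hx

/-- `H¹₀(Ω)` as a subspace of `L²(Ω) × L²(Ω; ℝ^N)`; the second component is the gradient. -/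
noncomputable def h10Submodule (Ω : Set (EuclideanSpace ℝ (Fin N)))
    [IsFiniteMeasure (volume.restrict Ω)] :
    Submodule ℝ (WithLp 2 (Lp ℝ 2 (volume.restrict Ω) ×
      Lp (EuclideanSpace ℝ (Fin N)) 2 (volume.restrict Ω))) where
  carrier := {U | IsH10 Ω U.fst U.snd}
  add_mem' {U V} hU hV := (hU.add hV).congr_ae (Lp.coeFn_add U.fst V.fst).symm
    (Lp.coeFn_add U.snd V.snd).symm
  zero_mem' := IsH10.zero.congr_ae (Lp.coeFn_zero _ _ _).symm (Lp.coeFn_zero _ _ _).symm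
  smul_mem' c U hU := (hU.const_smul c).congr_ae (Lp.coeFn_smul c U.fst).symm
    (Lp.coeFn_smul c U.snd).symm

theorem mem_h10Submodule [IsFiniteMeasure (volume.restrict Ω)]
    {U : WithLp 2 (Lp ℝ 2 (volume.restrict Ω) ×
      Lp (EuclideanSpace ℝ (Fin N)) 2 (volume.restrict Ω))} :
    U ∈ h10Submodule Ω ↔ IsH10 Ω U.fst U.snd := Iff.rfl

theorem isClosed_h10Submodule [IsFiniteMeasure (volume.restrict Ω)] :
    IsClosed (h10Submodule Ω : Set (WithLp 2 (Lp ℝ 2 (volume.restrict Ω) ×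
      Lp (EuclideanSpace ℝ (Fin N)) 2 (volume.restrict Ω)))) := by
  refine IsSeqClosed.isClosed fun U V hU hUV => ?_
  have h := ((WithLp.prod_continuous_ofLp 2 _ _).tendsto V).comp hUV
  exact IsH10.of_tendsto (Lp.memLp V.fst) (Lp.memLp V.snd) (fun k => hU k)
    ((Lp.tendsto_Lp_iff_tendsto_eLpNorm' _ _).1 h.fst_nhds)
    ((Lp.tendsto_Lp_iff_tendsto_eLpNorm' _ _).1 h.snd_nhds)

/-- The semilinear Dirichlet problem `-div (a ∇w) = b θ(w)` with `θ` nonincreasing. -/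
theorem exists_semilinear_solution [IsFiniteMeasure (volume.restrict Ω)]
    {a b : EuclideanSpace ℝ (Fin N) → ℝ} {θ : ℝ → ℝ} {α β B : ℝ} {C L : NNReal}
    (hC : ∀ u g, IsH10 Ω u g →
      eLpNorm u 2 (volume.restrict Ω) ≤ C * eLpNorm g 2 (volume.restrict Ω))
    (hα : 0 < α) (ha : AEStronglyMeasurable a (volume.restrict Ω))
    (hab : ∀ᵐ x ∂(volume.restrict Ω), α ≤ a x ∧ a x ≤ β)
    (hβ : 0 ≤ β) (hB : 0 ≤ B) (hb : AEStronglyMeasurable b (volume.restrict Ω))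
    (hbB : ∀ᵐ x ∂(volume.restrict Ω), 0 ≤ b x ∧ b x ≤ B)
    (hθ : Antitone θ) (hθL : LipschitzWith L θ) :
    ∃ w g, IsH10 Ω w g ∧ ∀ v h, IsH10 Ω v h →
      ∫ x in Ω, a x * ⟪g x, h x⟫ = ∫ x in Ω, b x * θ (w x) * v x := by
  set μ := volume.restrict Ω with hμ
  have hP : ∀ u : Lp ℝ 2 μ, MemLp (fun x => b x * θ (u x)) 2 μ := by
    intro u
    refine ((memLp_const |θ 0|).add ((Lp.memLp u).norm.const_mul (L : ℝ))).of_le_mul (c := B)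
      (hb.mul (hθL.continuous.comp_aestronglyMeasurable (Lp.memLp u).1)) ?_
    filter_upwards [hbB] with x hx
    have h₁ : |θ (u x)| ≤ |θ 0| + L * ‖u x‖ := by
      have := hθL.dist_le_mul (u x) 0
      rw [Real.dist_eq, dist_zero_right] at this
      linarith [abs_sub_abs_le_abs_sub (θ (u x)) (θ 0)]
    rw [norm_mul, Real.norm_eq_abs, Real.norm_eq_abs, abs_of_nonneg hx.1]
    refine mul_le_mul hx.2 (h₁.trans ?_) (abs_nonneg _) hB
    exact Real.le_norm_self _
  have hQ : ∀ g : Lp (EuclideanSpace ℝ (Fin N)) 2 μ, MemLp (fun x => a x • g x) 2 μ := by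
    intro g
    refine (Lp.memLp g).of_le_mul (c := β) (ha.smul (Lp.memLp g).1) ?_
    filter_upwards [hab] with x hx
    rw [norm_smul, Real.norm_eq_abs, abs_of_nonneg (hα.le.trans hx.1)]
    exact mul_le_mul_of_nonneg_right hx.2 (norm_nonneg _)
  set P : Lp ℝ 2 μ → Lp ℝ 2 μ := fun u => (hP u).toLp with hPdef
  set Q : Lp (EuclideanSpace ℝ (Fin N)) 2 μ → Lp (EuclideanSpace ℝ (Fin N)) 2 μ :=
    fun g => (hQ g).toLp with hQdef
  have hPsub : ∀ u v, ∀ᵐ x ∂μ, (P u - P v) x = b x * (θ (u x) - θ (v x)) := by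
    intro u v
    filter_upwards [Lp.coeFn_sub (P u) (P v), (hP u).coeFn_toLp, (hP v).coeFn_toLp]
      with x h₁ h₂ h₃
    rw [h₁, Pi.sub_apply, h₂, h₃]
    ring
  have hQsub : ∀ g h, ∀ᵐ x ∂μ, (Q g - Q h) x = a x • (g - h) x := by
    intro g h
    filter_upwards [Lp.coeFn_sub (Q g) (Q h), (hQ g).coeFn_toLp, (hQ h).coeFn_toLp,
      Lp.coeFn_sub g h] with x h₁ h₂ h₃ h₄
    rw [h₁, Pi.sub_apply, h₂, h₃, h₄, Pi.sub_apply, smul_sub]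
  -- Here the monotonicity of `θ` enters: with `b ≥ 0`, the lower-order term `-b θ(w)` is monotone
  -- and cannot hurt coercivity, whatever its Lipschitz constant.
  have c₁ : ∀ u v, 0 ≤ ⟪-P u - -P v, u - v⟫ := by
    intro u v
    rw [show -P u - -P v = -(P u - P v) by abel, inner_neg_left, neg_nonneg, L2.inner_def]
    refine integral_nonpos_of_ae ?_
    filter_upwards [hPsub u v, Lp.coeFn_sub u v, hbB] with x h₁ h₂ h₃
    rw [h₁, h₂, Pi.sub_apply, Pi.zero_apply, real_inner_eq_re_inner]
    simp only [RCLike.inner_apply, conj_trivial, RCLike.re_to_real]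
    rcases le_total (u x) (v x) with h | h
    · exact mul_nonpos_of_nonpos_of_nonneg (by linarith)
        (mul_nonneg h₃.1 (by linarith [hθ h]))
    · exact mul_nonpos_of_nonneg_of_nonpos (by linarith)
        (mul_nonpos_of_nonneg_of_nonpos h₃.1 (by linarith [hθ h]))
  have c₂ : ∀ g h, α * ‖g - h‖ ^ 2 ≤ ⟪Q g - Q h, g - h⟫ := by
    intro g h
    rw [← real_inner_self_eq_norm_sq, L2.inner_def, L2.inner_def, ← integral_const_mul]
    refine integral_mono_ae ((L2.integrable_inner _ _).const_mul α) (L2.integrable_inner _ _) ?_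
    filter_upwards [hQsub g h, hab] with x h₁ h₂
    rw [h₁, real_inner_smul_left]
    exact mul_le_mul_of_nonneg_right h₂.1 real_inner_self_nonneg
  have c₃ : ∀ u v, ‖-P u - -P v‖ ≤ B * L * ‖u - v‖ := by
    intro u v
    rw [show -P u - -P v = -(P u - P v) by abel, norm_neg]
    refine Lp.norm_le_mul_norm_of_ae_le_mul ?_
    filter_upwards [hPsub u v, Lp.coeFn_sub u v, hbB] with x h₁ h₂ h₃
    rw [h₁, h₂, Pi.sub_apply, norm_mul, mul_assoc, Real.norm_eq_abs, abs_of_nonneg h₃.1]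
    have := hθL.dist_le_mul (u x) (v x)
    rw [dist_eq_norm, dist_eq_norm] at this
    exact mul_le_mul h₃.2 this (norm_nonneg _) hB
  have c₄ : ∀ g h, ‖Q g - Q h‖ ≤ β * ‖g - h‖ := by
    intro g h
    refine Lp.norm_le_mul_norm_of_ae_le_mul ?_
    filter_upwards [hQsub g h, hab] with x h₁ h₂
    rw [h₁, norm_smul, Real.norm_eq_abs, abs_of_nonneg (hα.le.trans h₂.1)]
    exact mul_le_mul_of_nonneg_right h₂.2 (norm_nonneg _)
  have hpoinc : ∀ U ∈ h10Submodule Ω, ‖U.fst‖ ≤ C * ‖U.snd‖ := by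
    intro U hU
    have := ENNReal.toReal_mono (ENNReal.mul_ne_top ENNReal.coe_ne_top (Lp.memLp U.snd).2.ne)
      (hC _ _ (mem_h10Submodule.1 hU))
    rw [ENNReal.toReal_mul] at this
    exact this
  have : CompleteSpace (h10Submodule Ω) := isClosed_h10Submodule.completeSpace_coe
  -- Only the gradient component is coercive, with constant `α`; on `H¹₀` the Poincaré inequality
  -- bounds the full squared norm by `1 + C²` times that of the gradient, whence `α / (1 + C²)`.
  obtain ⟨W, hW, hWS⟩ := exists_orthogonal_of_stronglyMonotone (h10Submodule Ω)
    (fun U => WithLp.toLp 2 (-P U.fst, Q U.snd)) (c := α / (1 + C ^ 2)) (L := B * L + β)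
    (by positivity) (by positivity) (by
      intro U hU V hV
      have hUV := hpoinc _ (sub_mem hU hV)
      rw [WithLp.prod_inner_apply, WithLp.prod_norm_sq_eq_of_L2]
      have e₁ := c₁ U.fst V.fst
      have e₂ := c₂ U.snd V.snd
      have e₃ : ‖U.fst - V.fst‖ ^ 2 ≤ C ^ 2 * ‖U.snd - V.snd‖ ^ 2 := by
        rw [← mul_pow]
        exact pow_le_pow_left₀ (norm_nonneg _) hUV 2
      refine le_trans ?_ (add_le_add e₁ e₂)
      rw [zero_add, div_mul_eq_mul_div, div_le_iff₀ (by positivity), mul_assoc]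
      refine mul_le_mul_of_nonneg_left ?_ hα.le
      change ‖U.fst - V.fst‖ ^ 2 + ‖U.snd - V.snd‖ ^ 2 ≤ _
      linarith) (by
      intro U hU V hV
      refine (sq_le_sq₀ (norm_nonneg _) (by positivity)).1 ?_
      rw [mul_pow, WithLp.prod_norm_sq_eq_of_L2, WithLp.prod_norm_sq_eq_of_L2]
      change ‖-P U.fst - -P V.fst‖ ^ 2 + ‖Q U.snd - Q V.snd‖ ^ 2 ≤
        _ * (‖U.fst - V.fst‖ ^ 2 + ‖U.snd - V.snd‖ ^ 2)
      have hBL : 0 ≤ B * L := by positivity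
      rw [mul_add, ← mul_pow, ← mul_pow]
      refine add_le_add (pow_le_pow_left₀ (norm_nonneg _) ((c₃ _ _).trans ?_) 2)
        (pow_le_pow_left₀ (norm_nonneg _) ((c₄ _ _).trans ?_) 2)
      · exact mul_le_mul_of_nonneg_right (by linarith) (norm_nonneg _)
      · exact mul_le_mul_of_nonneg_right (by linarith) (norm_nonneg _))
  refine ⟨W.fst, W.snd, hW, fun v h hv => ?_⟩
  have hV : WithLp.toLp 2 (hv.memLp.toLp, hv.memLp_grad.toLp) ∈ h10Submodule Ω :=
    hv.congr_ae hv.memLp.coeFn_toLp.symm hv.memLp_grad.coeFn_toLp.symm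
  have := hWS _ hV
  rw [WithLp.prod_inner_apply] at this
  change ⟪-P W.fst, hv.memLp.toLp⟫ + ⟪Q W.snd, hv.memLp_grad.toLp⟫ = 0 at this
  rw [inner_neg_left, neg_add_eq_zero, L2.inner_def, L2.inner_def] at this
  refine Eq.trans (integral_congr_ae ?_) (this.symm.trans (integral_congr_ae ?_))
  · filter_upwards [(hQ W.snd).coeFn_toLp, hv.memLp_grad.coeFn_toLp] with x h₁ h₂
    rw [h₁, h₂, real_inner_smul_left]
  · filter_upwards [(hP W.fst).coeFn_toLp, hv.memLp.coeFn_toLp] with x h₁ h₂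
    rw [h₁, h₂]
    simp only [RCLike.inner_apply, conj_trivial]
    ring

/-! ### Sign and boundedness of weak solutions. -/

/-- Stampacchia's lemma on the decay of distribution functions. -/
theorem exists_eq_zero_of_decay {m : ℝ → ℝ} (hm0 : ∀ k, 0 ≤ m k) (hm : Antitone m) {K δ : ℝ}
    (hK : 0 ≤ K) (hδ : 0 < δ)
    (hdecay : ∀ k h, 0 ≤ k → k < h → (h - k) * m h ≤ K * m k ^ (1 + δ)) :
    ∃ d, 0 ≤ d ∧ m d = 0 := by
  set r : ℝ := (1 / 2 : ℝ) ^ (1 / δ) with hr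
  have hr0 : 0 < r := by positivity
  have hr1 : r < 1 := Real.rpow_lt_one (by norm_num) (by norm_num) (by positivity)
  have hrδ : r ^ δ = 1 / 2 := by
    rw [hr, ← Real.rpow_mul (by norm_num), one_div_mul_cancel hδ.ne', Real.rpow_one]
  -- Along the levels `d (1 - 2⁻ʲ)` the function `m` decays like `m 0 * r ^ j`. The induction closes
  -- when `2 K (m 0)^δ ≤ d r`, using `r ^ δ = 1/2`; the `+ 1` keeps `d` positive when `K` or `m 0`
  -- vanishes.
  set d : ℝ := 2 * K * m 0 ^ δ / r + 1 with hd
  have hd1 : 2 * K * m 0 ^ δ / r ≤ d := by linarith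
  have hd0 : 0 < d := by
    have : 0 ≤ 2 * K * m 0 ^ δ / r := by have := hm0 0; positivity
    linarith
  have hdr : 2 * K * m 0 ^ δ ≤ d * r := (div_le_iff₀ hr0).1 hd1
  have key : ∀ j : ℕ, m (d * (1 - (1 / 2) ^ j)) ≤ m 0 * r ^ j := by
    intro j
    induction j with
    | zero => simp
    | succ j ih =>
      have h2 : (0 : ℝ) < (1 / 2) ^ j := by positivity
      have h2' : ((1 : ℝ) / 2) ^ j ≤ 1 := pow_le_one₀ (by norm_num) (by norm_num)
      have hstep := hdecay (d * (1 - (1 / 2) ^ j)) (d * (1 - (1 / 2) ^ (j + 1)))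
        (mul_nonneg hd0.le (by linarith)) (by
          refine mul_lt_mul_of_pos_left ?_ hd0
          rw [pow_succ]
          linarith)
      have hp : m (d * (1 - (1 / 2) ^ j)) ^ (1 + δ) ≤ m 0 * m 0 ^ δ * (r ^ j * (1 / 2) ^ j) := by
        refine (Real.rpow_le_rpow (hm0 _) ih (by linarith)).trans (le_of_eq ?_)
        rw [Real.mul_rpow (hm0 0) (by positivity), Real.rpow_add' (hm0 0) (by linarith),
          Real.rpow_one, Real.rpow_add (by positivity), Real.rpow_one, ← Real.rpow_natCast r j,
          ← Real.rpow_mul hr0.le, mul_comm (j : ℝ) δ, Real.rpow_mul hr0.le, hrδ,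
          Real.rpow_natCast, Real.rpow_natCast]
      have hchain := hstep.trans (mul_le_mul_of_nonneg_left hp hK)
      have hfac : d * (1 - (1 / 2) ^ (j + 1)) - d * (1 - (1 / 2) ^ j)
          = d * (1 / 2) ^ j / 2 := by
        rw [pow_succ]; ring
      rw [hfac] at hchain
      have hpos : 0 < d * (1 / 2) ^ j / 2 := by positivity
      refine le_of_mul_le_mul_left (hchain.trans ?_) hpos
      have h3 := mul_le_mul_of_nonneg_right hdr
        (show 0 ≤ m 0 * r ^ j * (1 / 2) ^ j / 2 by have := hm0 0; positivity)
      calc K * (m 0 * m 0 ^ δ * (r ^ j * (1 / 2) ^ j))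
          = 2 * K * m 0 ^ δ * (m 0 * r ^ j * (1 / 2) ^ j / 2) := by ring
        _ ≤ d * r * (m 0 * r ^ j * (1 / 2) ^ j / 2) := h3
        _ = d * (1 / 2) ^ j / 2 * (m 0 * r ^ (j + 1)) := by rw [pow_succ]; ring
  refine ⟨d, hd0.le, le_antisymm ?_ (hm0 d)⟩
  have hlim : Tendsto (fun j : ℕ => m 0 * r ^ j) atTop (𝓝 0) := by
    simpa using (tendsto_pow_atTop_nhds_zero_of_lt_one hr0.le hr1).const_mul (m 0)
  refine ge_of_tendsto' hlim fun j => (hm ?_).trans (key j)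
  have h2 : (0 : ℝ) < (1 / 2) ^ j := by positivity
  nlinarith

theorem integral_norm_sq_eq {X F : Type*} [MeasurableSpace X] {μ : Measure X}
    [NormedAddCommGroup F] [InnerProductSpace ℝ F] {f : X → F} (hf : MemLp f 2 μ) :
    ∫ x, ‖f x‖ ^ 2 ∂μ = (eLpNorm f 2 μ).toReal ^ 2 := by
  rw [← Lp.norm_toLp f hf, ← real_inner_self_eq_norm_sq, L2.inner_def]
  refine integral_congr_ae ?_
  filter_upwards [hf.coeFn_toLp] with x hx
  rw [hx, real_inner_self_eq_norm_sq]

theorem integrable_mul_inner {X F : Type*} [MeasurableSpace X] {μ : Measure X}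
    [NormedAddCommGroup F] [InnerProductSpace ℝ F] {a : X → ℝ} {f g : X → F} {α β : ℝ}
    (hα : 0 < α) (ha : AEStronglyMeasurable a μ) (hab : ∀ᵐ x ∂μ, α ≤ a x ∧ a x ≤ β)
    (hf : MemLp f 2 μ) (hg : MemLp g 2 μ) : Integrable (fun x => a x * ⟪f x, g x⟫) μ := by
  have h : Integrable (fun x => ⟪f x, g x⟫) μ := by
    refine (L2.integrable_inner (𝕜 := ℝ) hf.toLp hg.toLp).congr ?_
    filter_upwards [hf.coeFn_toLp, hg.coeFn_toLp] with x h₁ h₂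
    rw [h₁, h₂]
  refine h.bdd_mul (c := β) ha ?_
  filter_upwards [hab] with x hx
  rw [Real.norm_eq_abs, abs_of_nonneg (hα.le.trans hx.1)]
  exact hx.2

section MaximumPrinciple

variable {a F w : EuclideanSpace ℝ (Fin N) → ℝ}
  {g : EuclideanSpace ℝ (Fin N) → EuclideanSpace ℝ (Fin N)} {α β M : ℝ}

/-- Testing with the negative part `w⁻` gives `α ∫ |∇w⁻|² ≤ -∫ F w⁻ ≤ 0`, and the Poincaré
inequality then forces `w⁻ = 0`. -/
theorem ae_nonneg_of_weak_solution [IsFiniteMeasure (volume.restrict Ω)] {C : NNReal}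
    (hC : ∀ u g, IsH10 Ω u g →
      eLpNorm u 2 (volume.restrict Ω) ≤ C * eLpNorm g 2 (volume.restrict Ω))
    (hα : 0 < α) (ha : AEStronglyMeasurable a (volume.restrict Ω))
    (hab : ∀ᵐ x ∂(volume.restrict Ω), α ≤ a x ∧ a x ≤ β)
    (hF : ∀ᵐ x ∂(volume.restrict Ω), 0 ≤ F x) (hw : IsH10 Ω w g)
    (hweak : ∀ v h, IsH10 Ω v h → ∫ x in Ω, a x * ⟪g x, h x⟫ = ∫ x in Ω, F x * v x) :
    ∀ᵐ x ∂(volume.restrict Ω), 0 ≤ w x := by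
  have hv := (hw.const_smul (-1)).max_sub le_rfl
  set v : EuclideanSpace ℝ (Fin N) → ℝ := fun x => max (-1 * w x - 0) 0 with hvdef
  set h : EuclideanSpace ℝ (Fin N) → EuclideanSpace ℝ (Fin N) :=
    fun x => (if 0 < -1 * w x then (1 : ℝ) else 0) • ((-1 : ℝ) • g x) with hh
  have h₁ : 0 ≤ ∫ x in Ω, F x * v x := integral_nonneg_of_ae (by
    filter_upwards [hF] with x hx
    exact mul_nonneg hx (le_max_right _ _))
  have hpt : ∀ x, ⟪g x, h x⟫ = -‖h x‖ ^ 2 := by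
    intro x
    simp only [hh]
    split_ifs
    · simp
    · simp
  have h₂ : α * ∫ x in Ω, ‖h x‖ ^ 2 ≤ - ∫ x in Ω, a x * ⟪g x, h x⟫ := by
    rw [← integral_neg, ← integral_const_mul]
    refine integral_mono_ae (hv.memLp_grad.norm.integrable_sq.const_mul α)
      (integrable_mul_inner hα ha hab hw.memLp_grad hv.memLp_grad).neg ?_
    filter_upwards [hab] with x hx
    rw [hpt, mul_neg, neg_neg]
    exact mul_le_mul_of_nonneg_right hx.1 (by positivity)
  rw [hweak v h hv, integral_norm_sq_eq hv.memLp_grad] at h₂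
  have h₃ : (eLpNorm h 2 (volume.restrict Ω)).toReal ^ 2 = 0 :=
    le_antisymm (by nlinarith) (sq_nonneg _)
  have h₄ : eLpNorm h 2 (volume.restrict Ω) = 0 := by
    have := pow_eq_zero_iff two_ne_zero |>.1 h₃
    exact ((ENNReal.toReal_eq_zero_iff _).1 this).resolve_right hv.memLp_grad.2.ne
  have h₅ : eLpNorm v 2 (volume.restrict Ω) = 0 := by
    have := hC v h hv
    rw [h₄, mul_zero] at this
    exact le_antisymm this zero_le
  rw [eLpNorm_eq_zero_iff hv.memLp.1 (by norm_num)] at h₅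
  filter_upwards [h₅] with x hx
  have : -1 * w x - 0 ≤ 0 := (le_max_left _ _).trans (le_of_eq hx)
  linarith

/-- Stampacchia's estimate: weak solutions with bounded right-hand side are bounded above. -/
theorem exists_ae_le_of_weak_solution (hN : 3 ≤ N) (hΩb : Bornology.IsBounded Ω)
    [IsFiniteMeasure (volume.restrict Ω)]
    (hα : 0 < α) (ha : AEStronglyMeasurable a (volume.restrict Ω))
    (hab : ∀ᵐ x ∂(volume.restrict Ω), α ≤ a x ∧ a x ≤ β) (hM : 0 ≤ M)
    (hFm : AEStronglyMeasurable F (volume.restrict Ω))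
    (hF : ∀ᵐ x ∂(volume.restrict Ω), |F x| ≤ M) (hw : IsH10 Ω w g)
    (hweak : ∀ v h, IsH10 Ω v h → ∫ x in Ω, a x * ⟪g x, h x⟫ = ∫ x in Ω, F x * v x) :
    ∃ d, 0 ≤ d ∧ ∀ᵐ x ∂(volume.restrict Ω), w x ≤ d := by
  have hN' : (3 : ℝ) ≤ N := by exact_mod_cast hN
  have hNinv : (N : ℝ)⁻¹ ≤ 1 / 3 := by
    rw [one_div]
    exact inv_anti₀ (by norm_num) hN'
  have hN0 : 0 < (N : ℝ)⁻¹ := by positivity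
  -- The critical Sobolev exponent `2N / (N - 2)`.
  set q : NNReal := ⟨((2 : ℝ)⁻¹ - (N : ℝ)⁻¹)⁻¹, by
    rw [inv_nonneg]; linarith⟩ with hq
  have hqinv : (q : ℝ)⁻¹ = (2 : ℝ)⁻¹ - (N : ℝ)⁻¹ := inv_inv _
  have hq1 : (1 : ℝ≥0∞) ≤ q := by
    have : (1 : ℝ) ≤ q := by
      change 1 ≤ ((2 : ℝ)⁻¹ - (N : ℝ)⁻¹)⁻¹
      rw [one_le_inv₀ (by linarith)]
      linarith
    exact_mod_cast this
  obtain ⟨C, hC⟩ := exists_sobolev_const hN hΩb (q := q) (by rw [hqinv])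
  set μ := volume.restrict Ω with hμ
  -- The exponent that Hölder's inequality puts on the measure of a level set. It exceeds `1/2`, and
  -- `2s = 1 + 2/N > 1` is the superlinearity Stampacchia's lemma needs.
  set s : ℝ := 1 - (q : ℝ)⁻¹ with hs
  have hs2 : s * 2 = 1 + 2 * (N : ℝ)⁻¹ := by rw [hs, hqinv]; ring
  have hs0 : 0 < s := by linarith
  -- Test with `v = (w - k)⁺`, and let `y` be the `L²` norm of its gradient and `m` the measure of
  -- `{w > k}`. Ellipticity gives `α y² ≤ M ∫ v`, while Hölder and Sobolev give `∫ v ≤ C y mˢ`;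
  -- cancelling one `y` bounds `y`, hence `∫ v`.
  have est : ∀ k, 0 ≤ k →
      ∫ x, max (w x - k) 0 ∂μ ≤ M * C ^ 2 / α * μ.real {x | k < w x} ^ (1 + 2 * (N : ℝ)⁻¹) := by
    intro k hk
    have hv := hw.max_sub hk
    set v : EuclideanSpace ℝ (Fin N) → ℝ := fun x => max (w x - k) 0 with hvdef
    set h : EuclideanSpace ℝ (Fin N) → EuclideanSpace ℝ (Fin N) :=
      fun x => (if k < w x then (1 : ℝ) else 0) • g x with hh
    have hv0 : ∀ x, 0 ≤ v x := fun x => le_max_right _ _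
    have hvint : Integrable v μ := hv.memLp.integrable (by norm_num)
    have hpt : ∀ x, ⟪g x, h x⟫ = ‖h x‖ ^ 2 := by
      intro x
      simp only [hh]
      split_ifs
      · simp
      · simp
    have h₁ : α * ∫ x, ‖h x‖ ^ 2 ∂μ ≤ M * ∫ x, v x ∂μ := by
      calc α * ∫ x, ‖h x‖ ^ 2 ∂μ ≤ ∫ x, a x * ⟪g x, h x⟫ ∂μ := by
            rw [← integral_const_mul]
            refine integral_mono_ae (hv.memLp_grad.norm.integrable_sq.const_mul α)
              (integrable_mul_inner hα ha hab hw.memLp_grad hv.memLp_grad) ?_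
            filter_upwards [hab] with x hx
            rw [hpt]
            exact mul_le_mul_of_nonneg_right hx.1 (by positivity)
        _ = ∫ x, F x * v x ∂μ := hweak v h hv
        _ ≤ M * ∫ x, v x ∂μ := by
            rw [← integral_const_mul]
            refine integral_mono_ae (hvint.bdd_mul (c := M) hFm hF) (hvint.const_mul M) ?_
            filter_upwards [hF] with x hx
            exact mul_le_mul_of_nonneg_right ((le_abs_self _).trans hx) (hv0 x)
    rw [integral_norm_sq_eq hv.memLp_grad] at h₁
    set y := (eLpNorm h 2 μ).toReal with hy
    set m := μ.real {x | k < w x} with hm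
    have hI : ∫ x, v x ∂μ ≤ C * y * m ^ s := by
      have e : ENNReal.ofReal (∫ x, v x ∂μ) = eLpNorm v 1 μ := by
        rw [eLpNorm_one_eq_lintegral_enorm, ofReal_integral_eq_lintegral_ofReal hvint
          (.of_forall hv0)]
        refine lintegral_congr fun x => ?_
        rw [Real.enorm_eq_ofReal (hv0 x)]
      have hsupp : Function.support v ⊆ {x | k < w x} := by
        intro x hx
        by_contra hx'
        have hle : w x ≤ k := not_lt.1 hx'
        exact hx (max_eq_right (by linarith))
      have h₂ : eLpNorm v 1 μ ≤ C * eLpNorm h 2 μ * μ {x | k < w x} ^ s := by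
        rw [← eLpNorm_restrict_eq_of_support_subset hsupp]
        refine (eLpNorm_le_eLpNorm_mul_rpow_measure_univ hq1
          (hv.memLp.1.mono_measure Measure.restrict_le_self)).trans ?_
        rw [Measure.restrict_apply_univ]
        simp only [ENNReal.toReal_one, div_one, ENNReal.coe_toReal, one_div]
        gcongr
        exact (eLpNorm_restrict_le _ _ _ _).trans (hC v h hv)
      have h₃ := ENNReal.toReal_mono (ENNReal.mul_ne_top (ENNReal.mul_ne_top ENNReal.coe_ne_top
        hv.memLp_grad.2.ne) (ENNReal.rpow_ne_top_of_nonneg hs0.le (measure_ne_top _ _))) h₂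
      rw [← e, ENNReal.toReal_ofReal (integral_nonneg hv0), ENNReal.toReal_mul,
        ENNReal.toReal_mul, ← ENNReal.toReal_rpow] at h₃
      exact h₃
    have hm0 : 0 ≤ m := measureReal_nonneg
    have hy0 : 0 ≤ y := ENNReal.toReal_nonneg
    have hms : 0 ≤ m ^ s := by positivity
    have hyle : α * y ≤ M * C * m ^ s := by
      rcases hy0.eq_or_lt with h0 | h0
      · rw [← h0, mul_zero]
        positivity
      · refine le_of_mul_le_mul_right ?_ h0
        have := h₁.trans (mul_le_mul_of_nonneg_left hI hM)
        linarith
    have hpow : m ^ (1 + 2 * (N : ℝ)⁻¹) = (m ^ s) ^ 2 := by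
      rw [← hs2, Real.rpow_mul hm0]
      exact_mod_cast Real.rpow_natCast (m ^ s) 2
    rw [hpow, div_mul_eq_mul_div, le_div_iff₀ hα]
    calc (∫ x, v x ∂μ) * α ≤ C * y * m ^ s * α := mul_le_mul_of_nonneg_right hI hα.le
      _ = C * m ^ s * (α * y) := by ring
      _ ≤ C * m ^ s * (M * C * m ^ s) := mul_le_mul_of_nonneg_left hyle (by positivity)
      _ = M * C ^ 2 * (m ^ s) ^ 2 := by ring
  obtain ⟨d, hd0, hd⟩ := exists_eq_zero_of_decay (m := fun k => μ.real {x | k < w x})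
    (K := M * C ^ 2 / α) (δ := 2 * (N : ℝ)⁻¹) (fun k => measureReal_nonneg)
    (fun k l hkl => measureReal_mono fun x hx => lt_of_le_of_lt hkl hx)
    (by positivity) (by positivity) (by
      intro k l hk hkl
      refine le_trans ?_ (est k hk)
      -- Chebyshev's inequality: `(w - k)⁺ ≥ l - k` on `{w > l}`.
      refine le_trans (mul_le_mul_of_nonneg_left (measureReal_mono ?_) (by linarith))
        (mul_meas_ge_le_integral_of_nonneg (.of_forall fun x => le_max_right _ _)
          ((hw.max_sub hk).memLp.integrable (by norm_num)) (l - k))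
      intro x hx
      have hx' : l < w x := hx
      exact le_trans (by linarith) (le_max_left (w x - k) 0))
  refine ⟨d, hd0, ?_⟩
  rw [measureReal_eq_zero_iff] at hd
  rw [ae_iff]
  simpa using hd

end MaximumPrinciple

/-! ### Kirchhoff's transformation and the regularised nonlinearity. -/

theorem continuous_trunc (k : ℝ) : Continuous (trunc k) := by
  unfold trunc
  fun_prop

theorem abs_trunc_le {k : ℝ} (hk : 0 ≤ k) (s : ℝ) : |trunc k s| ≤ k :=
  abs_le.2 ⟨le_max_left _ _, max_le (by linarith) (min_le_right _ _)⟩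

theorem trunc_nonneg {k s : ℝ} (hk : 0 ≤ k) (hs : 0 ≤ s) : 0 ≤ trunc k s :=
  (le_min hs hk).trans (le_max_right _ _)

/-- The inverse of `s ↦ ∫₀ˢ 1 / D` (Kirchhoff's transformation) solves `Ψ' = D(Ψ)`. -/
theorem exists_kirchhoff {D : ℝ → ℝ} (hD : Continuous D) {K : ℝ} (hD1 : ∀ s, 1 ≤ D s)
    (hDK : ∀ s, D s ≤ K) : ∃ Ψ : ℝ → ℝ, Ψ 0 = 0 ∧ ∀ t, HasDerivAt Ψ (D (Ψ t)) t := by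
  have hD0 : ∀ s, 0 < D s := fun s => one_pos.trans_le (hD1 s)
  have hK : 0 < K := (hD0 0).trans_le (hDK 0)
  have hDi : Continuous fun s => (D s)⁻¹ := hD.inv₀ fun s => (hD0 s).ne'
  set B : ℝ → ℝ := fun s => ∫ t in (0 : ℝ)..s, (D t)⁻¹ with hB
  have hB0 : B 0 = 0 := by simp [hB]
  have hBd : ∀ s, HasDerivAt B (D s)⁻¹ s := fun s =>
    intervalIntegral.integral_hasDerivAt_right (hDi.intervalIntegrable _ _)
      (hDi.stronglyMeasurableAtFilter _ _) hDi.continuousAt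
  have hBc : Continuous B := continuous_iff_continuousAt.2 fun s => (hBd s).continuousAt
  have hBs : StrictMono B := strictMono_of_deriv_pos fun s => by
    rw [(hBd s).deriv]
    exact inv_pos.2 (hD0 s)
  -- The upper bound on `D` makes `B` grow at least linearly, so it is onto `ℝ` and its inverse is
  -- defined everywhere.
  have hmono : Monotone fun s => B s - K⁻¹ * s := by
    have hd : ∀ s, HasDerivAt (fun s => B s - K⁻¹ * s) ((D s)⁻¹ - K⁻¹) s := fun s => by
      have := (hBd s).sub ((hasDerivAt_id s).const_mul K⁻¹)
      rwa [mul_one] at this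
    refine monotone_of_deriv_nonneg (fun s => (hd s).differentiableAt) fun s => ?_
    rw [(hd s).deriv, sub_nonneg]
    exact inv_anti₀ (hD0 s) (hDK s)
  have htop : Tendsto B atTop atTop := by
    refine tendsto_atTop_mono' atTop ?_ (tendsto_id.const_mul_atTop (inv_pos.2 hK))
    filter_upwards [eventually_ge_atTop 0] with s hs
    have := hmono hs
    simp only [hB0, mul_zero, sub_zero] at this
    simp only [id]
    linarith
  have hbot : Tendsto B atBot atBot := by
    refine tendsto_atBot_mono' atBot ?_ (tendsto_id.const_mul_atBot (inv_pos.2 hK))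
    filter_upwards [eventually_le_atBot 0] with s hs
    have := hmono hs
    simp only [hB0, mul_zero, sub_zero] at this
    simp only [id]
    linarith
  set e := hBs.orderIsoOfSurjective B (hBc.surjective htop hbot) with he
  have heB : ∀ t, B (e.symm t) = t := fun t => e.apply_symm_apply t
  refine ⟨e.symm, hBs.injective (by rw [heB, hB0]), fun t => ?_⟩
  have := HasDerivAt.of_local_left_inverse (f := B) (g := e.symm) (a := t)
    e.symm.continuous.continuousAt (hBd _) (inv_ne_zero (hD0 _).ne') (.of_forall heB)
  rwa [inv_inv] at this

/-- The positive part replaces the absolute value of the original equation: with `|t|` monotonicity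
would fail for `t < 0`. -/
theorem antitone_rpow_max {ε γ : ℝ} (hε : 0 < ε) (hγ : 0 < γ) :
    Antitone fun t : ℝ => ((max t 0 + ε) ^ γ)⁻¹ := by
  intro s t hst
  have : 0 ≤ max s 0 := le_max_right _ _
  refine inv_anti₀ (by positivity) (Real.rpow_le_rpow (by positivity) ?_ hγ.le)
  exact add_le_add_left (max_le_max_right 0 hst) ε

theorem inv_rpow_max_le {ε γ : ℝ} (hε : 0 < ε) (hγ : 0 < γ) (t : ℝ) :
    ((max t 0 + ε) ^ γ)⁻¹ ≤ (ε ^ γ)⁻¹ := by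
  refine inv_anti₀ (by positivity) (Real.rpow_le_rpow hε.le ?_ hγ.le)
  linarith [le_max_right t 0]

/-- The positive part is 1-Lipschitz and keeps the base in `[ε, ∞)`, where the derivative of `r ^
(-γ)` is largest in modulus at `ε`. -/
theorem lipschitzWith_rpow_max {ε γ : ℝ} (hε : 0 < ε) (hγ : 0 < γ) :
    ∃ L : NNReal, LipschitzWith L fun t : ℝ => ((max t 0 + ε) ^ γ)⁻¹ := by
  refine ⟨⟨γ * ε ^ (-γ - 1), by positivity⟩, LipschitzWith.of_dist_le_mul fun s t => ?_⟩
  have h := (convex_Ici ε).norm_image_sub_le_of_norm_hasDerivWithin_le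
    (f := fun r : ℝ => r ^ (-γ)) (f' := fun r => -γ * r ^ (-γ - 1)) (C := γ * ε ^ (-γ - 1))
    (fun r hr => (Real.hasDerivAt_rpow_const (Or.inl (hε.trans_le hr).ne')).hasDerivWithinAt)
    (fun r hr => by
      have hr' : ε ≤ r := hr
      rw [norm_mul, Real.norm_eq_abs, abs_neg, abs_of_pos hγ, Real.norm_eq_abs,
        abs_of_nonneg (Real.rpow_nonneg (hε.le.trans hr') _)]
      exact mul_le_mul_of_nonneg_left
        (Real.rpow_le_rpow_of_nonpos hε hr' (by linarith)) hγ.le)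
    (x := max t 0 + ε) (y := max s 0 + ε) (Set.mem_Ici.2 (by linarith [le_max_right t 0]))
    (Set.mem_Ici.2 (by linarith [le_max_right s 0]))
  have e : ∀ r : ℝ, ((max r 0 + ε) ^ γ)⁻¹ = (max r 0 + ε) ^ (-γ) := fun r => by
    have : 0 ≤ max r 0 := le_max_right _ _
    rw [Real.rpow_neg (by positivity)]
  rw [dist_eq_norm, e, e]
  refine h.trans (mul_le_mul_of_nonneg_left ?_ (by positivity))
  rw [add_sub_add_right_eq_sub, dist_eq_norm]
  exact abs_max_sub_max_le_abs s t 0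

end DegenerateElliptic

/-! ### Existence for the approximate problem. -/

theorem proposition2p1 {N : ℕ} (hN : 3 ≤ N)
    (Ω : Set (EuclideanSpace ℝ (Fin N))) (hΩ : IsOpen Ω) (hΩb : Bornology.IsBounded Ω)
    (p γ : ℝ) (hp : 0 < p) (hγ : 0 < γ)
    (α β : ℝ) (hα : 0 < α) (hβ : 0 < β)
    (a : EuclideanSpace ℝ (Fin N) → ℝ) (ha : AEMeasurable a (volume.restrict Ω))
    (hab : ∀ᵐ x ∂(volume.restrict Ω), α ≤ a x ∧ a x ≤ β)
    (m : ℝ≥0∞) (hm : 1 ≤ m)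
    (f : EuclideanSpace ℝ (Fin N) → ℝ) (hf : MemLp f m (volume.restrict Ω))
    (hf0 : ∀ᵐ x ∂(volume.restrict Ω), 0 ≤ f x)
    (n : ℕ) (hn : 1 ≤ n) :
    ∃ u : EuclideanSpace ℝ (Fin N) → ℝ,
      DegenerateElliptic.MemH10 Ω u ∧
      MemLp u ∞ (volume.restrict Ω) ∧
      (∀ᵐ x ∂(volume.restrict Ω), 0 ≤ u x) ∧
      DegenerateElliptic.IsApproxSolution Ω a f p γ n u := by
  open DegenerateElliptic in
  have : IsFiniteMeasure (volume.restrict Ω) := ⟨by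
    rw [Measure.restrict_apply_univ]
    exact hΩb.measure_lt_top⟩
  have hn0 : (0 : ℝ) ≤ n := n.cast_nonneg
  have hε : (0 : ℝ) < 1 / n := by
    have : (0 : ℝ) < n := by exact_mod_cast hn
    positivity
  have ha' := ha.aestronglyMeasurable
  set D : ℝ → ℝ := fun s => (1 + |trunc n s|) ^ p with hD
  have hD1 : ∀ s, 1 ≤ D s := fun s =>
    Real.one_le_rpow (by linarith [abs_nonneg (trunc n s)]) hp.le
  have hDK : ∀ s, D s ≤ (1 + n) ^ p := fun s =>
    Real.rpow_le_rpow (by positivity) (by linarith [abs_trunc_le hn0 s]) hp.le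
  have hDc : Continuous D := (continuous_const.add (continuous_trunc n).abs).rpow_const
    fun s => Or.inr hp.le
  obtain ⟨Ψ, hΨ0, hΨ⟩ := exists_kirchhoff hDc hD1 hDK
  have hΨc : Continuous Ψ := continuous_iff_continuousAt.2 fun s => (hΨ s).continuousAt
  have hΨm : Monotone Ψ := monotone_of_deriv_nonneg (fun s => (hΨ s).differentiableAt)
    fun s => by
      rw [(hΨ s).deriv]
      linarith [hD1 (Ψ s)]
  have hD0 : ∀ s, 0 < D s := fun s => one_pos.trans_le (hD1 s)
  have hΨL : LipschitzWith (Real.toNNReal ((1 + n) ^ p)) Ψ :=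
    lipschitzWith_of_nnnorm_deriv_le (fun s => (hΨ s).differentiableAt) fun s => by
      rw [← NNReal.coe_le_coe, Real.coe_toNNReal _ (by positivity), coe_nnnorm, (hΨ s).deriv, Real.norm_eq_abs,
        abs_of_pos (hD0 _)]
      exact hDK _
  obtain ⟨L, hL⟩ := lipschitzWith_rpow_max hε hγ
  -- The subcritical case `q = 2` is the Poincaré inequality.
  obtain ⟨C, hC⟩ := exists_sobolev_const hN hΩb (q := 2) (by simp)
  have hbB : ∀ᵐ x ∂(volume.restrict Ω), 0 ≤ trunc n (f x) ∧ trunc n (f x) ≤ n := by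
    filter_upwards [hf0] with x hx
    exact ⟨trunc_nonneg hn0 hx, (le_abs_self _).trans (abs_trunc_le hn0 _)⟩
  have hbm : AEStronglyMeasurable (fun x => trunc n (f x)) (volume.restrict Ω) :=
    (continuous_trunc n).comp_aestronglyMeasurable hf.1
  set θ : ℝ → ℝ := fun s => ((max (Ψ s) 0 + 1 / n) ^ γ)⁻¹ with hθ
  have hθ0 : ∀ s, 0 ≤ θ s := fun s => by
    have : 0 ≤ max (Ψ s) 0 := le_max_right _ _
    positivity
  have hθL : LipschitzWith _ θ := hL.comp hΨL
  obtain ⟨w, g, hw, hweak⟩ := exists_semilinear_solution hC hα ha' hab hβ.le hn0 hbm hbB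
    ((antitone_rpow_max hε hγ).comp_monotone hΨm) hθL
  have hFm : AEStronglyMeasurable (fun x => trunc n (f x) * θ (w x)) (volume.restrict Ω) :=
    hbm.mul (hθL.continuous.comp_aestronglyMeasurable hw.memLp.1)
  have hF : ∀ᵐ x ∂(volume.restrict Ω), 0 ≤ trunc n (f x) * θ (w x) ∧
      |trunc n (f x) * θ (w x)| ≤ n * ((1 / n : ℝ) ^ γ)⁻¹ := by
    filter_upwards [hbB] with x hx
    have h0 := mul_nonneg hx.1 (hθ0 (w x))
    refine ⟨h0, ?_⟩
    rw [abs_of_nonneg h0]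
    exact mul_le_mul hx.2 (inv_rpow_max_le hε hγ _) (hθ0 _) hn0
  have hw0 : ∀ᵐ x ∂(volume.restrict Ω), 0 ≤ w x :=
    ae_nonneg_of_weak_solution hC hα ha' hab (hF.mono fun x hx => hx.1) hw hweak
  obtain ⟨d, -, hwd⟩ := exists_ae_le_of_weak_solution hN hΩb hα ha' hab (by positivity) hFm
    (hF.mono fun x hx => hx.2) hw hweak
  have hu0 : ∀ᵐ x ∂(volume.restrict Ω), 0 ≤ Ψ (w x) := by
    filter_upwards [hw0] with x hx
    exact hΨ0 ▸ hΨm hx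
  have hu : IsH10 Ω (fun x => Ψ (w x)) (fun x => D (Ψ (w x)) • g x) :=
    hw.comp hΨ (hDc.comp hΨc) hΨ0 (L := (1 + n) ^ p) fun s => by
      rw [abs_of_pos (hD0 _)]
      exact hDK _
  refine ⟨fun x => Ψ (w x), ⟨_, hu⟩, ?_, hu0, _, hu, fun v h hv => ?_⟩
  · refine memLp_top_of_bound (hΨc.comp_aestronglyMeasurable hw.memLp.1) (Ψ d) ?_
    filter_upwards [hu0, hwd] with x h₁ h₂
    rw [Real.norm_eq_abs, abs_of_nonneg h₁]
    exact hΨm h₂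
  -- The factor `D(u)` in `∇u = D(u) ∇w` cancels the degenerate denominator exactly.
  · have e₁ : ∀ x, a x / (1 + |trunc n (Ψ (w x))|) ^ p * ⟪D (Ψ (w x)) • g x, h x⟫
        = a x * ⟪g x, h x⟫ := fun x => by
      have := (hD0 (Ψ (w x))).ne'
      rw [real_inner_smul_left, ← mul_assoc]
      congr 1
      exact div_mul_cancel₀ _ this
    -- Nonnegativity of `u` is what identifies the modified right-hand side with the original one.
    have e₂ : (fun x => trunc n (f x) * θ (w x) * v x) =ᵐ[volume.restrict Ω]
        fun x => trunc n (f x) / (|Ψ (w x)| + 1 / (n : ℝ)) ^ γ * v x := by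
      filter_upwards [hu0] with x hx
      rw [abs_of_nonneg hx, hθ]
      simp only [max_eq_left hx]
      rw [← div_eq_mul_inv (trunc n (f x))]
    refine ⟨?_, ?_, ?_⟩
    · simp only [e₁]
      exact integrable_mul_inner hα ha' hab hw.memLp_grad hv.memLp_grad
    · exact Integrable.congr ((hv.memLp.integrable (by norm_num)).bdd_mul hFm
        (hF.mono fun x hx => hx.2)) e₂
    · simp only [e₁]
      exact (hweak v h hv).trans (integral_congr_ae e₂)
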